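/- **Definitions.** Let $\Gamma\subset\mathbb R^n$ be open, with $\Gamma\supset\Gamma_+=\{k: k_i>0 \text{ for all } i\}$ and $\Gamma$ invariant under permutations of the coordinates. A *Weingarten function* $W\in C^\infty(\Gamma)$ is a function that is symmetric, homogeneous (of some real degree) and, on $\Gamma_+$, positive and (weakly) increasing in each variable. For an oriented hypersurface (immersion) $f:M^n\to\mathbb S^{n+1}$ with unit normal $N$ and principal curvatures $k_1,\dots,k_n$ (counted with multiplicity; eigenvalues of the shape operator $A$, $dN=-df\circ A$), $W_f:=W(k_1,\dots,k_n)$ is *well defined* if $(k_1,\dots,k_n)\in\Gamma$ at every point of $M$. A *parallel $\varphi$-flow solution with initial data $f$* on $[0,T)$, $0<T\le+\infty$, is a family of immersions $F_t(p)=\exp_{f(p)}(\varphi(t)N(p))$, with unit normals $N(p,t)=d\exp_{f(p)}(\varphi(t)N(p))N(p)$, where $\varphi\in C^\infty[0,T)$ and $\varphi(0)=0$, such that $W_{F_t}$ is well defined for all $t$ and $\frac{\partial F}{\partial t}(p,t)=W_{F_t}(p)\,N(p,t)$. It is *the maximal one* if every other such solution is a restriction of it to a smaller interval. **Isoparametric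 family.** Let $g\ge 1$, let $M$ be a non-empty smooth $n$-manifold, and let $P:\mathbb R^{n+2}\to\mathbb R$ be a homogeneous polynomial of degree $g$. Let $\mathscr F=\{f_\tau:M\to\mathbb S^{n+1};\ \tau\in(0,\pi/g)\}$ be a family of parallel hypersurfaces, each with constant principal curvatures, exactly $g$ of them distinct, such that $f_\tau(M)=\{x\in\mathbb S^{n+1}: P(x)=\cos(g\tau)\}$, with the positive orientation: $\tau\mapsto f_\tau(p)$ is a unit speed geodesic $\gamma$ for each $p\in M$, and the unit normal of $f_\tau$ at $p$ is $-\gamma'(\tau)$. (Then $\tau$ is the distance from $f_\tau(M)$ to $\mathscr F_+$, and the distinct principal curvatures of $f_\tau$ are $\cot(\tau+(i-1)\pi/g)$, $1\le i\le g$.) Its focal sets are $\mathscr F_\pm=\{x\in\mathbb S^{n+1}:P(x)=\pm1\}$. **Theorem.** Let $\mathscr F$ be such a family and $W\in C^\infty(\Gamma)$ a Weingarten function such that $W_{f_\tau}$ is well defined for all $\tau\in(0,\pi/g)$. Let $\tau_0\in(0,\pi/g)$, and assume that $W_{f_{\tau_0}}>0$ (resp. $W_{f_{\tau_0}}<0$)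 and that the function $\tau\mapsto W_{f_{\tau_0-\tau}}$ is (weakly) increasing on $[0,\tau_0)$ (resp. $\tau\mapsto W_{f_{\tau_0+\tau}}$ is (weakly) decreasing on $[0,\pi/g-\tau_0)$). Then there is a (unique) maximal parallel $\varphi$-flow solution $F_t$, $t\in[0,T)$, with initial data $f_{\tau_0}$. It has $T<+\infty$ and $F_t=f_{\tau_0-\varphi(t)}$ with $\varphi(t)\in[0,\tau_0)$ (resp. $\varphi(t)\in(\tau_0-\pi/g,0]$) for all $t\in[0,T)$. The function $\varphi$ is strictly increasing with $\lim_{t\to T}\varphi(t)=\tau_0$ (resp. strictly decreasing with $\lim_{t\to T}\varphi(t)=\tau_0-\pi/g$), so that $T=\varphi^{-1}(\tau_0)$ (resp. $T=\varphi^{-1}(\tau_0-\pi/g)$) for the continuous extension of $\varphi$ to $[0,T]$. At $t=T$ the flow collapses into $\mathscr F_+$ (resp. $\mathscr F_-$): as $t\to T$, $F_t$ converges uniformly to a smooth map of $M$ onto $\mathscr F_+$ (resp. $\mathscr F_-$) which is nowhere an immersion. -/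

import Mathlib

open Set Filter Topology
open scoped Manifold ContDiff

/-! ### Hypersurfaces of the unit sphere

The unit sphere `𝕊ⁿ⁺¹` is the set of unit vectors of `ℝⁿ⁺²`. Maps into it are written as maps into
`ℝⁿ⁺²` with unit values, so that the differentials of such a map and of a unit normal field along it
are linear maps `T_pM → ℝⁿ⁺²`. -/

/-- The Euclidean space `ℝⁿ⁺²` which contains the sphere `𝕊ⁿ⁺¹`. -/
abbrev Amb (n : ℕ) : Type := EuclideanSpace ℝ (Fin (n + 2))

section Hypersurface

variable {n : ℕ} {M : Type*} [TopologicalSpace M] [ChartedSpace (EuclideanSpace ℝ (Fin n)) M]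

/-- `f : Mⁿ → 𝕊ⁿ⁺¹` is a smooth immersion, and `N` is a smooth unit normal field along `f`,
tangent to the sphere. -/
structure IsOrientedHypersurface (f N : M → Amb n) : Prop where
  mem_sphere : ∀ p, f p ∈ Metric.sphere (0 : Amb n) 1
  smooth : ContMDiff (𝓡 n) 𝓘(ℝ, Amb n) ∞ f
  immersion : ∀ p, Function.Injective (mvfderiv (𝓡 n) f p)
  smooth_normal : ContMDiff (𝓡 n) 𝓘(ℝ, Amb n) ∞ N
  norm_normal : ∀ p, ‖N p‖ = 1
  normal_tangent_sphere : ∀ p, inner ℝ (N p) (f p) = 0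
  normal_orthogonal : ∀ (p : M) (v : TangentSpace (𝓡 n) p),
    inner ℝ (N p) (mvfderiv (𝓡 n) f p v) = 0

/-- `k = (k₁, …, kₙ)` lists, with multiplicities, the principal curvatures of `f` at `p` with respect
to the unit normal `N`: there is a basis `b` of `T_pM` with `dN(bᵢ) = - kᵢ df(bᵢ)`, that is, `bᵢ` is an
eigenvector with eigenvalue `kᵢ` of the shape operator `A`, which is given by `dN = - df ∘ A`. -/
def HasPrincipalCurvatures (f N : M → Amb n) (p : M) (k : Fin n → ℝ) : Prop :=
  ∃ b : Module.Basis (Fin n) ℝ (TangentSpace (𝓡 n) p), ∀ i,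
    mvfderiv (𝓡 n) N p (b i) = -(k i) • mvfderiv (𝓡 n) f p (b i)

open Classical in
/-- The principal curvatures of `f` at `p`, with multiplicities, listed in some order. (They exist for
every oriented hypersurface since the shape operator is self-adjoint, and are unique up to order.) -/
noncomputable def principalCurvatures (f N : M → Amb n) (p : M) : Fin n → ℝ :=
  if h : ∃ k, HasPrincipalCurvatures f N p k then h.choose else 0

/-- The function `W_f(p) = W(k₁(p), …, kₙ(p))` of the hypersurface `f` with unit normal `N`. -/
noncomputable def weingartenOf (W : (Fin n → ℝ) → ℝ) (f N : M → Amb n) (p : M) : ℝ :=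
  W (principalCurvatures f N p)

/-- `W_f` is well defined: the principal curvatures of `f` lie everywhere in the domain `Γ` of `W`. -/
def WeingartenWellDefined (Γ : Set (Fin n → ℝ)) (f N : M → Amb n) : Prop :=
  ∀ p, principalCurvatures f N p ∈ Γ

end Hypersurface

/-- The positive cone `Γ₊` of `ℝⁿ`. -/
def positiveCone (n : ℕ) : Set (Fin n → ℝ) := {k | ∀ i, 0 < k i}

/-- `W ∈ C^∞(Γ)` is a Weingarten function on the open set `Γ ⊇ Γ₊` of `ℝⁿ`: it is symmetric,
homogeneous (of some degree), and, on the positive cone, (weakly) increasing in each variable and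
positive. -/
structure IsWeingartenFunction {n : ℕ} (Γ : Set (Fin n → ℝ)) (W : (Fin n → ℝ) → ℝ) : Prop where
  isOpen : IsOpen Γ
  cone_subset : positiveCone n ⊆ Γ
  smooth : ContDiffOn ℝ ∞ W Γ
  symmetric : ∀ k ∈ Γ, ∀ σ : Equiv.Perm (Fin n), k ∘ σ ∈ Γ ∧ W (k ∘ σ) = W k
  homogeneous : ∃ d : ℝ, ∀ k ∈ Γ, ∀ c : ℝ, 0 < c → c • k ∈ Γ → W (c • k) = c ^ d * W k
  increasing : ∀ k ∈ positiveCone n, ∀ (i : Fin n) (x : ℝ), k i ≤ x → W k ≤ W (Function.update k i x)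
  positive : ∀ k ∈ positiveCone n, 0 < W k

/-! ### Parallel Weingarten flows -/

/-- The point `exp_x(s u)` of the sphere, for a unit vector `x` and a unit tangent vector `u` at `x`:
the unit speed great circle that issues from `x` in the direction `u`. -/
noncomputable def sphereExp {n : ℕ} (x u : Amb n) (s : ℝ) : Amb n := Real.cos s • x + Real.sin s • u

/-- The velocity `d exp_x(s u) u` of the great circle `s ↦ exp_x(s u)`. -/
noncomputable def sphereExpVelocity {n : ℕ} (x u : Amb n) (s : ℝ) : Amb n :=
  Real.cos s • u - Real.sin s • x

/-- The time interval `[0, T)`, where `T ≤ +∞`. -/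
def timeInterval (T : EReal) : Set ℝ := {t | 0 ≤ t ∧ (t : EReal) < T}

section Flow

variable {n : ℕ} {M : Type*} [TopologicalSpace M] [ChartedSpace (EuclideanSpace ℝ (Fin n)) M]

/-- The maps `F_t(p) = exp_{f(p)}(φ(t) N(p))`. -/
noncomputable def parallelMap (f N : M → Amb n) (φ : ℝ → ℝ) (t : ℝ) (p : M) : Amb n :=
  sphereExp (f p) (N p) (φ t)

/-- The normals `N(p, t) = d exp_{f(p)}(φ(t) N(p)) N(p)` of the maps `F_t`. -/
noncomputable def parallelNormal (f N : M → Amb n) (φ : ℝ → ℝ) (t : ℝ) (p : M) : Amb n :=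
  sphereExpVelocity (f p) (N p) (φ t)

/-- The parallel `φ`-flow `F_t(p) = exp_{f(p)}(φ(t) N(p))`, `t ∈ [0, T)`, `φ ∈ C^∞[0, T)`, `φ(0) = 0`,
is a `W`-flow with initial data `f`: the `F_t` are immersions whose Weingarten function is well
defined, and `∂F/∂t (p, t) = W_{F_t}(p) N(p, t)`. -/
structure IsParallelWFlow (Γ : Set (Fin n → ℝ)) (W : (Fin n → ℝ) → ℝ) (f N : M → Amb n)
    (φ : ℝ → ℝ) (T : EReal) : Prop where
  pos : 0 < T
  zero : φ 0 = 0
  smooth : ContDiffOn ℝ ∞ φ (timeInterval T)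
  hypersurface : ∀ t ∈ timeInterval T,
    IsOrientedHypersurface (parallelMap f N φ t) (parallelNormal f N φ t)
  wellDefined : ∀ t ∈ timeInterval T,
    WeingartenWellDefined Γ (parallelMap f N φ t) (parallelNormal f N φ t)
  evolution : ∀ t ∈ timeInterval T, ∀ p,
    HasDerivWithinAt (fun s => parallelMap f N φ s p)
      (weingartenOf W (parallelMap f N φ t) (parallelNormal f N φ t) p • parallelNormal f N φ t p)
      (timeInterval T) t

/-- The maximal parallel `W`-flow with initial data `f`: every other one is a restriction of it. -/
structure IsMaximalParallelWFlow (Γ : Set (Fin n → ℝ)) (W : (Fin n → ℝ) → ℝ) (f N : M → Amb n)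
    (φ : ℝ → ℝ) (T : EReal) : Prop where
  isFlow : IsParallelWFlow Γ W f N φ T
  maximal : ∀ (ψ : ℝ → ℝ) (S : EReal), IsParallelWFlow Γ W f N ψ S →
    S ≤ T ∧ EqOn ψ φ (timeInterval S)

/-- `F_t` collapses into the set `S` at the time `T`: as `t` increases to `T`, the maps `F_t` converge
uniformly to a map of `M` onto `S` which is nowhere an immersion. -/
def CollapsesInto (F : ℝ → M → Amb n) (S : Set (Amb n)) (T : ℝ) : Prop :=
  ∃ L : M → Amb n, TendstoUniformly F L (𝓝[<] T) ∧ range L = S ∧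
    ContMDiff (𝓡 n) 𝓘(ℝ, Amb n) ∞ L ∧
    ∀ p, ¬ Function.Injective (mvfderiv (𝓡 n) L p)

end Flow

/-! ### Isoparametric families -/

/-- The part of the level set `P = c` that lies in the unit sphere. -/
def sphereLevel {n : ℕ} (P : MvPolynomial (Fin (n + 2)) ℝ) (c : ℝ) : Set (Amb n) :=
  {x | x ∈ Metric.sphere (0 : Amb n) 1 ∧ MvPolynomial.eval (fun i => x i) P = c}

/-- The focal set `𝓕₊ = P⁻¹(1)`. -/
def focalPlus {n : ℕ} (P : MvPolynomial (Fin (n + 2)) ℝ) : Set (Amb n) := sphereLevel P 1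

/-- The focal set `𝓕₋ = P⁻¹(-1)`. -/
def focalMinus {n : ℕ} (P : MvPolynomial (Fin (n + 2)) ℝ) : Set (Amb n) := sphereLevel P (-1)

section Isoparametric

variable {n : ℕ} {M : Type*} [TopologicalSpace M] [ChartedSpace (EuclideanSpace ℝ (Fin n)) M]

/-- `{f_τ : M → 𝕊ⁿ⁺¹; τ ∈ (0, π/g)}`, with unit normals `N_τ`, is a family of positively oriented
isoparametric hypersurfaces with `g` distinct principal curvatures, whose members are the level sets
in the sphere of the homogeneous polynomial `P` of degree `g`.

Here `τ` is the distance to `𝓕₊ = P⁻¹(1)`, which makes `f_τ(M)` the level set `P = cos (g τ)`, and the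
positive orientation is `N_τ(p) = -γ'(τ)`, where `γ` is the unit speed normal geodesic
`τ ↦ γ(τ) = f_τ(p)` that runs from `𝓕₊` to `𝓕₋ = P⁻¹(-1)`. -/
structure IsIsoparametricFamily (g : ℕ) (P : MvPolynomial (Fin (n + 2)) ℝ) (f N : ℝ → M → Amb n) :
    Prop where
  homogeneous : P.IsHomogeneous g
  hypersurface : ∀ τ ∈ Ioo 0 (Real.pi / g), IsOrientedHypersurface (f τ) (N τ)
  parallel : ∀ τ ∈ Ioo 0 (Real.pi / g), ∀ σ ∈ Ioo 0 (Real.pi / g), ∀ p,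
    f σ p = sphereExp (f τ p) (N τ p) (τ - σ)
  isoparametric : ∀ τ ∈ Ioo 0 (Real.pi / g), ∃ k : Fin n → ℝ,
    (∀ p, HasPrincipalCurvatures (f τ) (N τ) p k) ∧ (range k).ncard = g
  range_eq : ∀ τ ∈ Ioo 0 (Real.pi / g), range (f τ) = sphereLevel P (Real.cos (g * τ))

end Isoparametric

/-! Principal curvatures are constant on each `f τ`, so a parallel flow through the family is one
scalar equation `φ' = h(φ)`, where `h s` is the value of `W` on the parallel hypersurface `f (τ₀ -
s)`. Monotonicity gives `h ≥ h 0 > 0` on `[0, τ₀)`. The time to reach `s` is the integral of `1/h`,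
at most `τ₀ / h 0`, so its inverse function is a solution that arrives at `τ₀` in finite time
(`exists_maximal_solution_of_monotoneOn`). The negative case follows by reflecting `s ↦ -s`.

Maximality and the collapse need the geometry at the focal distance. A competing flow could outlast
this one only by taking the focal value, where the parallel map is not an immersion
(`not_injective_focalMap`). To see this, identities for `P` are carried by analyticity from the
regular levels to the whole space: `P` is a cosine along normal great circles and `|∇P|² =
g²|x|^(2g-2)`. Hence `∇P` along a normal great circle is an explicit combination of position and
velocity (`gradient_sphereExp`). Away from multiples of `π/g` the velocity is then a function of the
position, so the parallel map is an immersion. Every curvature must therefore be some `cot (τ + m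
π/g)`. There are at most `g` such numbers and `g` distinct curvatures, so all of them occur,
including those that produce the two focal points.

The limit map is onto the focal set because regular points are dense in the sphere and the image is
compact (`range_focalMap`). -/

/-! ### Differentials of vector-valued maps on a manifold -/

section Derivatives

variable {n : ℕ} {M : Type*} [TopologicalSpace M] [ChartedSpace (EuclideanSpace ℝ (Fin n)) M]
  {F : Type*} [NormedAddCommGroup F] [NormedSpace ℝ F]
  {E : Type*} [NormedAddCommGroup E] [NormedSpace ℝ E]

theorem mvfderiv_comp_of_differentiableAt {G : E → F} {f : M → E} {p : M}
    (hG : DifferentiableAt ℝ G (f p)) (hf : MDifferentiableAt (𝓡 n) 𝓘(ℝ, E) f p)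
    (v : TangentSpace (𝓡 n) p) :
    mvfderiv (𝓡 n) (fun q => G (f q)) p v = fderiv ℝ G (f p) (mvfderiv (𝓡 n) f p v) := by
  have h := mfderiv_comp p hG.mdifferentiableAt hf
  rw [mfderiv_eq_fderiv] at h
  exact congrArg (fun A => A v) h

theorem mvfderiv_lincomb {f N : M → E} {p : M} (hf : MDifferentiableAt (𝓡 n) 𝓘(ℝ, E) f p)
    (hN : MDifferentiableAt (𝓡 n) 𝓘(ℝ, E) N p) (a b : ℝ) (v : TangentSpace (𝓡 n) p) :
    mvfderiv (𝓡 n) (fun q => a • f q + b • N q) p v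
      = a • mvfderiv (𝓡 n) f p v + b • mvfderiv (𝓡 n) N p v := by
  have h1 := mvfderiv_comp_of_differentiableAt (G := fun x : E => a • x) (f := f) (p := p)
    (by fun_prop) hf v
  have h2 := mvfderiv_comp_of_differentiableAt (G := fun x : E => b • x) (f := N) (p := p)
    (by fun_prop) hN v
  have e1 : fderiv ℝ (fun x : E => a • x) (f p) = a • ContinuousLinearMap.id ℝ E :=
    (a • ContinuousLinearMap.id ℝ E).fderiv
  have e2 : fderiv ℝ (fun x : E => b • x) (N p) = b • ContinuousLinearMap.id ℝ E :=
    (b • ContinuousLinearMap.id ℝ E).fderiv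
  rw [e1] at h1
  rw [e2] at h2
  have ha : MDifferentiableAt (𝓡 n) 𝓘(ℝ, E) (fun q => a • f q) p :=
    DifferentiableAt.comp_mdifferentiableAt (g := fun x : E => a • x) (f := f)
      (by fun_prop) hf
  have hb : MDifferentiableAt (𝓡 n) 𝓘(ℝ, E) (fun q => b • N q) p :=
    DifferentiableAt.comp_mdifferentiableAt (g := fun x : E => b • x) (f := N)
      (by fun_prop) hN
  have h3 := congrArg (fun A => A v) (mvfderiv_fun_add ha hb)
  calc _ = _ := h3
    _ = mvfderiv (𝓡 n) (fun q => a • f q) p v + mvfderiv (𝓡 n) (fun q => b • N q) p v := rfl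
    _ = _ := by rw [h1, h2]; rfl

theorem mvfderiv_eq_zero_of_forall_eq {f : M → E} {p : M} {c : E} (h : ∀ q, f q = c)
    (v : TangentSpace (𝓡 n) p) : mvfderiv (𝓡 n) f p v = 0 := by
  obtain rfl : f = fun _ => c := funext h
  rw [mvfderiv_const]; rfl

end Derivatives

/-! ### Great circles of the sphere -/

section GreatCircles

variable {n : ℕ}

theorem sphereExp_zero (x u : Amb n) : sphereExp x u 0 = x := by simp [sphereExp]

theorem sphereExpVelocity_zero (x u : Amb n) : sphereExpVelocity x u 0 = u := by
  simp [sphereExpVelocity]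

theorem sphereExp_sphereExp (x u : Amb n) (s t : ℝ) :
    sphereExp (sphereExp x u s) (sphereExpVelocity x u s) t = sphereExp x u (s + t) := by
  simp only [sphereExp, sphereExpVelocity, Real.cos_add, Real.sin_add]
  module

theorem hasDerivAt_sphereExp (x u : Amb n) (s : ℝ) :
    HasDerivAt (sphereExp x u) (sphereExpVelocity x u s) s := by
  have h := ((Real.hasDerivAt_cos s).smul_const x).add ((Real.hasDerivAt_sin s).smul_const u)
  convert! h using 1
  simp only [sphereExpVelocity]; module

theorem norm_sphereExp {x u : Amb n} (hx : ‖x‖ = 1) (hu : ‖u‖ = 1) (hxu : inner ℝ u x = 0) (s : ℝ) :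
    ‖sphereExp x u s‖ = 1 := by
  rw [← sq_eq_sq₀ (norm_nonneg _) zero_le_one, ← real_inner_self_eq_norm_sq]
  have hx' : inner ℝ x x = 1 := by rw [real_inner_self_eq_norm_sq, hx]; norm_num
  have hu' : inner ℝ u u = 1 := by rw [real_inner_self_eq_norm_sq, hu]; norm_num
  simp only [sphereExp, inner_add_left, inner_add_right, real_inner_smul_left,
    real_inner_smul_right, real_inner_comm u x, hxu, hx', hu']
  nlinarith [Real.sin_sq_add_cos_sq s]

theorem norm_sphereExpVelocity {x u : Amb n} (hx : ‖x‖ = 1) (hu : ‖u‖ = 1)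
    (hxu : inner ℝ u x = 0) (s : ℝ) : ‖sphereExpVelocity x u s‖ = 1 := by
  have h := norm_sphereExp hx hu hxu (s + Real.pi / 2)
  rw [sphereExp, Real.cos_add_pi_div_two, Real.sin_add_pi_div_two] at h
  rw [← h, sphereExpVelocity]; congr 1; module

theorem inner_sphereExpVelocity_sphereExp {x u : Amb n} (hx : ‖x‖ = 1) (hu : ‖u‖ = 1)
    (hxu : inner ℝ u x = 0) (s : ℝ) :
    inner ℝ (sphereExpVelocity x u s) (sphereExp x u s) = 0 := by
  have hx' : inner ℝ x x = 1 := by rw [real_inner_self_eq_norm_sq, hx]; norm_num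
  have hu' : inner ℝ u u = 1 := by rw [real_inner_self_eq_norm_sq, hu]; norm_num
  simp only [sphereExp, sphereExpVelocity, inner_add_right, inner_sub_left, real_inner_smul_left,
    real_inner_smul_right, real_inner_comm u x, hxu, hx', hu']
  ring

theorem norm_sphereExp_sub_le {x u : Amb n} (hx : ‖x‖ = 1) (hu : ‖u‖ = 1) (s t : ℝ) :
    ‖sphereExp x u s - sphereExp x u t‖
      ≤ |Real.cos s - Real.cos t| + |Real.sin s - Real.sin t| := by
  have : sphereExp x u s - sphereExp x u t
      = (Real.cos s - Real.cos t) • x + (Real.sin s - Real.sin t) • u := by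
    simp only [sphereExp]; module
  rw [this]
  refine (norm_add_le _ _).trans ?_
  simp [norm_smul, hx, hu]

end GreatCircles

/-! ### Homogeneous polynomials: analyticity, Euler's identity, scaling of the gradient -/

section Homogeneous

variable {n g : ℕ}

/-- The function on `ℝⁿ⁺²` that the polynomial `P` defines. -/
noncomputable def polyFun (P : MvPolynomial (Fin (n + 2)) ℝ) (x : Amb n) : ℝ :=
  MvPolynomial.eval (fun i => x i) P

theorem analyticOnNhd_polyFun (P : MvPolynomial (Fin (n + 2)) ℝ) :
    AnalyticOnNhd ℝ (polyFun P) univ := by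
  intro x _
  have h := AnalyticAt.aeval_mvPolynomial (f := fun (y : Amb n) (i : Fin (n + 2)) => y i) (z := x)
    (fun i => (EuclideanSpace.proj i : Amb n →L[ℝ] ℝ).analyticAt x) P
  simp only [MvPolynomial.aeval_eq_eval] at h
  exact h

theorem differentiable_polyFun (P : MvPolynomial (Fin (n + 2)) ℝ) :
    Differentiable ℝ (polyFun P) :=
  fun x => (analyticOnNhd_polyFun P x trivial).differentiableAt

theorem continuous_polyFun (P : MvPolynomial (Fin (n + 2)) ℝ) : Continuous (polyFun P) :=
  (differentiable_polyFun P).continuous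

theorem inner_gradient_polyFun (P : MvPolynomial (Fin (n + 2)) ℝ) (x v : Amb n) :
    inner ℝ (gradient (polyFun P) x) v = fderiv ℝ (polyFun P) x v := by
  simp [gradient]

theorem analyticOnNhd_gradient_polyFun (P : MvPolynomial (Fin (n + 2)) ℝ) :
    AnalyticOnNhd ℝ (gradient (polyFun P)) univ := by
  have h : gradient (polyFun P) = fun x => ∑ i, fderiv ℝ (polyFun P) x
      (EuclideanSpace.basisFun (Fin (n + 2)) ℝ i) • EuclideanSpace.basisFun (Fin (n + 2)) ℝ i := by
    funext x
    rw [← (EuclideanSpace.basisFun (Fin (n + 2)) ℝ).sum_repr' (gradient (polyFun P) x)]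
    refine Finset.sum_congr rfl fun i _ => ?_
    rw [real_inner_comm, inner_gradient_polyFun]
  rw [h]
  intro x _
  refine Finset.analyticAt_fun_sum _ fun i _ => ?_
  exact (((ContinuousLinearMap.apply ℝ ℝ (EuclideanSpace.basisFun (Fin (n + 2)) ℝ i)).analyticAt
    _).comp ((analyticOnNhd_polyFun P).fderiv x trivial)).smul analyticAt_const

theorem differentiable_gradient_polyFun (P : MvPolynomial (Fin (n + 2)) ℝ) :
    Differentiable ℝ (gradient (polyFun P)) :=
  fun x => (analyticOnNhd_gradient_polyFun P x trivial).differentiableAt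

theorem polyFun_smul {P : MvPolynomial (Fin (n + 2)) ℝ} (hP : P.IsHomogeneous g) (c : ℝ)
    (x : Amb n) : polyFun P (c • x) = c ^ g * polyFun P x := by
  simp only [polyFun, MvPolynomial.eval_eq, Finset.mul_sum]
  refine Finset.sum_congr rfl fun d hd => ?_
  have hdeg : ∑ i, d i = g := by
    have := hP (MvPolynomial.mem_support_iff.1 hd)
    rw [← this, Finsupp.weight_apply, Finsupp.sum_fintype _ _ (by simp)]; simp
  rw [Finset.prod_subset (Finset.subset_univ d.support) (by intro i _ hi; simp_all),
    Finset.prod_subset (Finset.subset_univ d.support) (by intro i _ hi; simp_all)]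
  simp only [PiLp.smul_apply, smul_eq_mul, mul_pow, Finset.prod_mul_distrib]
  rw [Finset.prod_pow_eq_pow_sum, hdeg]; ring

theorem fderiv_polyFun_self {P : MvPolynomial (Fin (n + 2)) ℝ} (hP : P.IsHomogeneous g)
    (x : Amb n) : fderiv ℝ (polyFun P) x x = g * polyFun P x := by
  have h1 : HasDerivAt (fun c : ℝ => polyFun P (c • x)) (fderiv ℝ (polyFun P) x x) 1 := by
    have hc : HasDerivAt (fun c : ℝ => c • x) x 1 := by
      simpa using (hasDerivAt_id (1 : ℝ)).smul_const x
    have h := (differentiable_polyFun P ((1 : ℝ) • x)).hasFDerivAt.comp_hasDerivAt 1 hc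
    rwa [one_smul] at h
  have h2 : HasDerivAt (fun c : ℝ => c ^ g * polyFun P x) (g * polyFun P x) 1 := by
    simpa using (hasDerivAt_pow g (1 : ℝ)).mul_const (polyFun P x)
  have h3 : (fun c : ℝ => polyFun P (c • x)) = fun c => c ^ g * polyFun P x :=
    funext fun c => polyFun_smul hP c x
  rw [h3] at h1
  exact h1.unique h2

theorem gradient_polyFun_smul {P : MvPolynomial (Fin (n + 2)) ℝ} (hP : P.IsHomogeneous g)
    (hg : g ≠ 0) {c : ℝ} (hc : c ≠ 0) (x : Amb n) :
    gradient (polyFun P) (c • x) = c ^ (g - 1) • gradient (polyFun P) x := by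
  refine ext_inner_right ℝ fun v => ?_
  rw [real_inner_smul_left, inner_gradient_polyFun, inner_gradient_polyFun]
  have h1 : HasFDerivAt (fun y : Amb n => polyFun P (c • y))
      ((fderiv ℝ (polyFun P) (c • x)).comp (c • ContinuousLinearMap.id ℝ (Amb n))) x :=
    (differentiable_polyFun P (c • x)).hasFDerivAt.comp x
      (c • ContinuousLinearMap.id ℝ (Amb n)).hasFDerivAt
  have h2 : HasFDerivAt (fun y : Amb n => c ^ g * polyFun P y)
      (c ^ g • fderiv ℝ (polyFun P) x) x :=
    (differentiable_polyFun P x).hasFDerivAt.const_mul _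
  have h3 : (fun y : Amb n => polyFun P (c • y)) = fun y => c ^ g * polyFun P y :=
    funext fun y => polyFun_smul hP c y
  rw [h3] at h1
  have h4 := congrArg (fun A => A v) (h1.unique h2)
  simp only [ContinuousLinearMap.comp_apply, smul_apply,
    ContinuousLinearMap.id_apply, map_smul, smul_eq_mul] at h4
  apply mul_left_cancel₀ hc
  rw [h4, ← mul_assoc, mul_pow_sub_one hg]

end Homogeneous

/-! ### Uniqueness of eigenvalues up to order -/

section Eigenbases

variable {n : ℕ} {V E : Type*} [AddCommGroup V] [Module ℝ V] [AddCommGroup E] [Module ℝ E]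

theorem charpoly_eq_prod_of_eigenbasis (A : V →ₗ[ℝ] V) (b : Module.Basis (Fin n) ℝ V)
    (k : Fin n → ℝ) (h : ∀ i, A (b i) = k i • b i) :
    (LinearMap.toMatrix b b A).charpoly
      = ∏ i, (Polynomial.X - Polynomial.C (k i)) := by
  have : LinearMap.toMatrix b b A = Matrix.diagonal k := by
    ext i j
    rw [LinearMap.toMatrix_apply, h, map_smul, Module.Basis.repr_self]
    by_cases hij : i = j
    · subst hij; simp
    · simp [hij]
  rw [this, Matrix.charpoly_diagonal]

theorem exists_perm_of_prod_X_sub_C_eq {k l : Fin n → ℝ}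
    (h : ∏ i, (Polynomial.X - Polynomial.C (k i)) = ∏ i, (Polynomial.X - Polynomial.C (l i))) :
    ∃ σ : Equiv.Perm (Fin n), l ∘ σ = k := by
  classical
  have hm : Multiset.map k Finset.univ.val = Multiset.map l Finset.univ.val := by
    have := congrArg Polynomial.roots h
    rwa [Polynomial.roots_prod _ _ (Finset.prod_ne_zero_iff.2 fun i _ => Polynomial.X_sub_C_ne_zero _),
      Polynomial.roots_prod _ _ (Finset.prod_ne_zero_iff.2 fun i _ => Polynomial.X_sub_C_ne_zero _),
      Multiset.bind_congr (fun i _ => Polynomial.roots_X_sub_C (k i)),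
      Multiset.bind_congr (fun i _ => Polynomial.roots_X_sub_C (l i)),
      Multiset.bind_singleton, Multiset.bind_singleton] at this
  have hcard : ∀ c, Fintype.card {i // k i = c} = Fintype.card {i // l i = c} := by
    intro c
    have := congrArg (Multiset.count c) hm
    rw [Multiset.count_map, Multiset.count_map] at this
    rw [Fintype.card_subtype, Fintype.card_subtype, Finset.card_def, Finset.card_def,
      Finset.filter_val, Finset.filter_val]
    simpa only [eq_comm] using this
  -- Equal root multisets mean fibres of equal size over each value; bijections between fibres glue
  -- to a permutation.
  refine ⟨Equiv.ofFiberEquiv fun c => Fintype.equivOfCardEq (hcard c), funext fun i => ?_⟩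
  exact Equiv.ofFiberEquiv_map _ i

/-- If `B = -D ∘ A` with `D` injective, the eigenvalues of `A` are unique up to order. -/
theorem exists_perm_of_relative_eigenbases {D B : V →ₗ[ℝ] E} (hD : Function.Injective D)
    {b c : Module.Basis (Fin n) ℝ V} {k l : Fin n → ℝ}
    (hb : ∀ i, B (b i) = -(k i) • D (b i)) (hc : ∀ i, B (c i) = -(l i) • D (c i)) :
    ∃ σ : Equiv.Perm (Fin n), l ∘ σ = k := by
  classical
  have : Module.Finite ℝ V := Module.Finite.of_basis b
  have : Module.Free ℝ V := Module.Free.of_basis b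
  -- The endomorphism `A` is rebuilt from the first basis; injectivity of `D` makes the second basis
  -- diagonalise the same `A`, so both lists are the roots of one characteristic polynomial.
  let A : V →ₗ[ℝ] V := b.constr ℝ fun i => k i • b i
  have hA : ∀ i, A (b i) = k i • b i := fun i => b.constr_basis ℝ _ i
  have hBA : B = -(D ∘ₗ A) := by
    refine b.ext fun i => ?_
    rw [hb, LinearMap.neg_apply, LinearMap.comp_apply, hA, map_smul, neg_smul]
  have hA' : ∀ i, A (c i) = l i • c i := by
    intro i
    apply hD
    have := hc i
    rw [hBA, LinearMap.neg_apply, LinearMap.comp_apply, neg_smul, neg_inj] at this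
    rw [this, map_smul]
  apply exists_perm_of_prod_X_sub_C_eq
  rw [← charpoly_eq_prod_of_eigenbasis A b k hA, ← charpoly_eq_prod_of_eigenbasis A c l hA',
    LinearMap.charpoly_toMatrix, LinearMap.charpoly_toMatrix]

end Eigenbases

/-! ### The autonomous scalar equation -/

section AutonomousODE

theorem timeInterval_coe (T : ℝ) : timeInterval (T : EReal) = Ico 0 T := by
  ext t; simp [timeInterval]

theorem mem_timeInterval_of_le {T : EReal} {s t : ℝ} (ht : t ∈ timeInterval T) (h0 : 0 ≤ s)
    (hst : s ≤ t) : s ∈ timeInterval T :=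
  ⟨h0, lt_of_le_of_lt (EReal.coe_le_coe_iff.2 hst) ht.2⟩

/-- Bootstrapping: if `φ` is of class `C^m`, then so is `φ' = h ∘ φ`, hence `φ` is of class
`C^(m+1)`. -/
theorem contDiffOn_of_hasDerivAt_comp {h φ : ℝ → ℝ} {U I : Set ℝ} (hU : IsOpen U)
    (hh : ContDiffOn ℝ ∞ h I) (hφI : MapsTo φ U I)
    (hφ : ∀ t ∈ U, HasDerivAt φ (h (φ t)) t) : ContDiffOn ℝ ∞ φ U := by
  have key : ∀ m : ℕ, ContDiffOn ℝ m φ U := by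
    intro m
    induction m with
    | zero =>
      rw [Nat.cast_zero, contDiffOn_zero]
      exact fun t ht => (hφ t ht).continuousAt.continuousWithinAt
    | succ m ih =>
      rw [Nat.cast_succ, contDiffOn_succ_iff_deriv_of_isOpen hU]
      refine ⟨fun t ht => (hφ t ht).differentiableAt.differentiableWithinAt, by simp, ?_⟩
      refine ContDiffOn.congr ?_ fun t ht => (hφ t ht).deriv
      exact (hh.of_le (by exact_mod_cast le_top)).comp ih hφI
  exact contDiffOn_infty.2 key

/-- A solution of the autonomous equation `φ' = h(φ)` whose speed is positive and increasing
reaches the end `b` of the interval in finite time, and it extends every other solution that does not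
attain the value `b`. -/
theorem exists_maximal_solution_of_monotoneOn {h : ℝ → ℝ} {a b : ℝ} (ha : a < 0) (hb : 0 < b)
    (hsm : ContDiffOn ℝ ∞ h (Ioo a b)) (h0 : 0 < h 0) (hmono : MonotoneOn h (Ico 0 b)) :
    ∃ (φ : ℝ → ℝ) (T : ℝ), 0 < T ∧ φ 0 = 0 ∧ ContDiffOn ℝ ∞ φ (Ico 0 T) ∧
      (∀ t ∈ Ico 0 T, φ t ∈ Ico 0 b) ∧
      (∀ t ∈ Ico 0 T, HasDerivWithinAt φ (h (φ t)) (Ico 0 T) t) ∧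
      StrictMonoOn φ (Ico 0 T) ∧ Tendsto φ (𝓝[<] T) (𝓝 b) ∧
      ∀ (ψ : ℝ → ℝ) (S : EReal), ψ 0 = 0 → DifferentiableOn ℝ ψ (timeInterval S) →
        (∀ t ∈ timeInterval S, ψ t ∈ Ioo a b →
          HasDerivWithinAt ψ (h (ψ t)) (timeInterval S) t) →
        (∀ t ∈ timeInterval S, ψ t ≠ b) → S ≤ T ∧ EqOn ψ φ (timeInterval S) := by
  have hcont : ContinuousOn h (Ioo a b) := hsm.continuousOn
  -- Positivity holds on `[0, b)` by monotonicity and slightly to the left of `0` by continuity.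
  -- This makes `0` an interior point, so that the inverse function is smooth up to time `0`.
  obtain ⟨a', haa', ha'0, hpos⟩ : ∃ a', a < a' ∧ a' < 0 ∧ ∀ s ∈ Ioo a' b, 0 < h s := by
    have hc0 : ContinuousAt h 0 := hcont.continuousAt (Ioo_mem_nhds ha hb)
    have hev : ∀ᶠ s in 𝓝 (0 : ℝ), 0 < h s := hc0.eventually (lt_mem_nhds h0)
    obtain ⟨c, d, ⟨hc, hd⟩, hcd⟩ := mem_nhds_iff_exists_Ioo_subset.1 hev
    refine ⟨max (a / 2) c, by rw [lt_max_iff]; left; linarith, max_lt (by linarith) hc,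
      fun s hs => ?_⟩
    rcases lt_or_ge s 0 with h' | h'
    · exact hcd ⟨(le_max_right _ _).trans_lt hs.1, h'.trans hd⟩
    · exact h0.trans_le (hmono ⟨le_rfl, hb⟩ ⟨h', hs.2⟩ h')
  have hsub : Ioo a' b ⊆ Ioo a b := Ioo_subset_Ioo_left haa'.le
  have h0mem : (0 : ℝ) ∈ Ioo a' b := ⟨ha'0, hb⟩
  have hinv : ContinuousOn (fun s => (h s)⁻¹) (Ioo a' b) :=
    (hcont.mono hsub).inv₀ fun s hs => (hpos s hs).ne'
  -- Separation of variables: `Ψ s` is the time at which the solution reaches `s`.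
  set Ψ : ℝ → ℝ := fun s => ∫ u in (0 : ℝ)..s, (h u)⁻¹ with hΨ
  have hΨ0 : Ψ 0 = 0 := by simp [hΨ]
  have hΨd : ∀ s ∈ Ioo a' b, HasStrictDerivAt Ψ (h s)⁻¹ s := by
    intro s hs
    have hss : uIcc 0 s ⊆ Ioo a' b := ordConnected_Ioo.uIcc_subset h0mem hs
    refine intervalIntegral.integral_hasStrictDerivAt_right
      ((hinv.mono hss).intervalIntegrable) ?_ (hinv.continuousAt (isOpen_Ioo.mem_nhds hs))
    exact hinv.stronglyMeasurableAtFilter isOpen_Ioo s hs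
  have hΨc : ContinuousOn Ψ (Ioo a' b) := fun s hs =>
    (hΨd s hs).hasDerivAt.continuousAt.continuousWithinAt
  have hΨm : StrictMonoOn Ψ (Ioo a' b) := by
    refine strictMonoOn_of_deriv_pos (convex_Ioo a' b) hΨc fun s hs => ?_
    rw [interior_Ioo] at hs
    rw [(hΨd s hs).hasDerivAt.deriv]
    exact inv_pos.2 (hpos s hs)
  have hIco : Ico 0 b ⊆ Ioo a' b := fun s hs => ⟨ha'0.trans_le hs.1, hs.2⟩
  -- Since `h ≥ h 0`, the arrival times are bounded by `b / h 0`; this is what makes `T` finite.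
  have hΨle : ∀ s ∈ Ico 0 b, Ψ s ≤ b / h 0 := by
    intro s hs
    have hd : ∀ u ∈ Ioo a' b, HasDerivAt (fun u => u / h 0 - Ψ u) (1 / h 0 - (h u)⁻¹) u :=
      fun u hu => ((hasDerivAt_id u).div_const (h 0)).sub (hΨd u hu).hasDerivAt
    have hm : MonotoneOn (fun u => u / h 0 - Ψ u) (Ico 0 b) := by
      refine monotoneOn_of_deriv_nonneg (convex_Ico 0 b)
        (fun u hu => (hd u (hIco hu)).continuousAt.continuousWithinAt)
        (fun u hu => ?_) fun u hu => ?_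
      · rw [interior_Ico] at hu
        exact (hd u (hIco (Ioo_subset_Ico_self hu))).differentiableAt.differentiableWithinAt
      · rw [interior_Ico] at hu
        rw [(hd u (hIco (Ioo_subset_Ico_self hu))).deriv, sub_nonneg, one_div]
        exact inv_anti₀ h0 (hmono ⟨le_rfl, hb⟩ (Ioo_subset_Ico_self hu) hu.1.le)
    have := hm ⟨le_rfl, hb⟩ hs hs.1
    simp only [hΨ0, zero_div, sub_zero] at this
    have h2 : s / h 0 ≤ b / h 0 := by gcongr; exact hs.2.le
    linarith
  set T : ℝ := sSup (Ψ '' Ico 0 b) with hT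
  have hbdd : BddAbove (Ψ '' Ico 0 b) := ⟨b / h 0, by rintro _ ⟨s, hs, rfl⟩; exact hΨle s hs⟩
  have hΨT : ∀ s ∈ Ioo a' b, Ψ s < T := by
    intro s hs
    obtain ⟨s', hs1, hs2⟩ := exists_between (max_lt hs.2 hb)
    have hs' : s' ∈ Ico 0 b := ⟨(le_max_right s 0).trans hs1.le, hs2⟩
    exact (hΨm hs (hIco hs') ((le_max_left _ _).trans_lt hs1)).trans_le
      (le_csSup hbdd ⟨s', hs', rfl⟩)
  have hTpos : 0 < T := by simpa [hΨ0] using hΨT 0 h0mem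
  have hsurj : ∀ t ∈ Ico 0 T, ∃ s ∈ Ico 0 b, Ψ s = t := by
    intro t ht
    obtain ⟨_, ⟨s₁, hs₁, rfl⟩, hts⟩ := exists_lt_of_lt_csSup (s := Ψ '' Ico 0 b)
      ⟨Ψ 0, 0, ⟨le_rfl, hb⟩, rfl⟩ ht.2
    have : Icc 0 s₁ ⊆ Ioo a' b := fun u hu => hIco ⟨hu.1, hu.2.trans_lt hs₁.2⟩
    obtain ⟨s, hs, hst⟩ := intermediate_value_Icc hs₁.1 (hΨc.mono this)
      (show t ∈ Icc (Ψ 0) (Ψ s₁) from ⟨by rw [hΨ0]; exact ht.1, hts.le⟩)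
    exact ⟨s, ⟨hs.1, hs.2.trans_lt hs₁.2⟩, hst⟩
  set φ : ℝ → ℝ := Function.invFunOn Ψ (Ioo a' b) with hφ
  have hφΨ : ∀ s ∈ Ioo a' b, φ (Ψ s) = s := fun s hs => hΨm.injOn.leftInvOn_invFunOn hs
  have hφmem : ∀ t ∈ Ico 0 T, φ t ∈ Ico 0 b := by
    intro t ht
    obtain ⟨s, hs, rfl⟩ := hsurj t ht
    rwa [hφΨ s (hIco hs)]
  have hΨφ : ∀ t ∈ Ico 0 T, Ψ (φ t) = t := by
    intro t ht
    obtain ⟨s, hs, rfl⟩ := hsurj t ht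
    rw [hφΨ s (hIco hs)]
  have hφd : ∀ s ∈ Ioo a' b, HasDerivAt φ (h (φ (Ψ s))) (Ψ s) := by
    intro s hs
    have := (hΨd s hs).to_local_left_inverse (inv_ne_zero (hpos s hs).ne') (g := φ)
      (by filter_upwards [isOpen_Ioo.mem_nhds hs] with u hu using hφΨ u hu)
    rw [inv_inv] at this
    rw [hφΨ s hs]
    exact this.hasDerivAt
  have hUo : IsOpen (Ψ '' Ioo a' b) := by
    rw [isOpen_iff_mem_nhds]
    rintro _ ⟨s, hs, rfl⟩
    rw [← (hΨd s hs).map_nhds_eq (inv_ne_zero (hpos s hs).ne')]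
    exact image_mem_map (isOpen_Ioo.mem_nhds hs)
  have hIcoU : Ico 0 T ⊆ Ψ '' Ioo a' b := fun t ht => by
    obtain ⟨s, hs, rfl⟩ := hsurj t ht
    exact ⟨s, hIco hs, rfl⟩
  have hφsm : ContDiffOn ℝ ∞ φ (Ψ '' Ioo a' b) :=
    contDiffOn_of_hasDerivAt_comp hUo hsm
      (by rintro _ ⟨s, hs, rfl⟩; rw [hφΨ s hs]; exact hsub hs)
      (by rintro _ ⟨s, hs, rfl⟩; exact hφd s hs)
  have hφmono : StrictMonoOn φ (Ico 0 T) := by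
    intro t ht u hu htu
    rw [← hΨφ t ht, ← hΨφ u hu] at htu
    exact (hΨm.lt_iff_lt (hIco (hφmem t ht)) (hIco (hφmem u hu))).1 htu
  refine ⟨φ, T, hTpos, by simpa [hΨ0] using hφΨ 0 h0mem, hφsm.mono hIcoU, hφmem, ?_, hφmono,
    ?_, ?_⟩
  · intro t ht
    obtain ⟨s, hs, rfl⟩ := hIcoU ht
    exact (hφd s hs).hasDerivWithinAt
  · rw [tendsto_order]
    constructor
    · intro c hc
      have hm : max c 0 ∈ Ico 0 b := ⟨le_max_right _ _, max_lt hc hb⟩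
      have hlt := hΨT _ (hIco hm)
      filter_upwards [Ioo_mem_nhdsLT (max_lt hlt hTpos)] with t ht
      have ht' : t ∈ Ico 0 T := ⟨((le_max_right _ _).trans_lt ht.1).le, ht.2⟩
      refine (le_max_left c 0).trans_lt ?_
      rw [← hΨm.lt_iff_lt (hIco hm) (hIco (hφmem t ht')), hΨφ t ht']
      exact (le_max_left _ _).trans_lt ht.1
    · intro c hc
      filter_upwards [Ioo_mem_nhdsLT hTpos] with t ht
      exact (hφmem t (Ioo_subset_Ico_self ht)).2.trans hc
  · intro ψ S hψ0 hψc hψd hψb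
    -- A competitor cannot pass `b` without attaining it, and cannot become negative, so it obeys
    -- the equation throughout and `Ψ ∘ ψ` has derivative `1`.
    have key : ∀ t ∈ timeInterval S, ψ t ∈ Ico 0 b ∧ Ψ (ψ t) = t := by
      intro t ht
      have hsubI : Icc 0 t ⊆ timeInterval S := fun u hu => mem_timeInterval_of_le ht hu.1 hu.2
      have hc : ContinuousOn ψ (Icc 0 t) := hψc.continuousOn.mono hsubI
      have hlt : ∀ u ∈ Icc 0 t, ψ u < b := by
        intro u hu
        by_contra hge
        obtain ⟨v, hv, hvb⟩ := intermediate_value_Icc hu.1 (hc.mono (Icc_subset_Icc_right hu.2))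
          (show b ∈ Icc (ψ 0) (ψ u) from ⟨by rw [hψ0]; exact hb.le, not_lt.1 hge⟩)
        exact hψb v (hsubI ⟨hv.1, hv.2.trans hu.2⟩) hvb
      have hder : ∀ u ∈ Icc 0 t, u < t → ψ u ∈ Ioo a b →
          HasDerivWithinAt ψ (h (ψ u)) (Ici u) u := by
        intro u hu hut hψu
        refine ((hψd u (hsubI hu) hψu).mono
          ((Icc_subset_Icc_left hu.1).trans hsubI)).mono_of_mem_nhdsWithin ?_
        exact Icc_mem_nhdsGE hut
      -- Zero is a barrier: wherever `ψ` vanishes its right derivative is `h 0 > 0`. The equation is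
      -- used only at such zeros, because it is not known where `ψ` leaves `(a, b)`.
      have hnn : ∀ u ∈ Icc 0 t, 0 ≤ ψ u := by
        have hd' : ∀ u ∈ Ico 0 t,
            HasDerivWithinAt (fun u => -ψ u) (-derivWithin ψ (timeInterval S) u) (Ici u) u := by
          intro u hu
          refine (((hψc u (hsubI (Ico_subset_Icc_self hu))).hasDerivWithinAt.mono
            ((Icc_subset_Icc_left hu.1).trans hsubI)).mono_of_mem_nhdsWithin ?_).neg
          exact Icc_mem_nhdsGE hu.2
        have hle := image_le_of_deriv_right_lt_deriv_boundary' hc.neg hd' (B := fun _ => 0)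
          (B' := fun _ => 0) (by simp [hψ0]) continuousOn_const
          (fun u _ => hasDerivWithinAt_const _ _ _) ?_
        · intro u hu
          simpa using hle hu
        · intro u hu h0u
          have hψu : ψ u = 0 := by simpa using h0u
          have hu' := hsubI (Ico_subset_Icc_self hu)
          have hud : UniqueDiffWithinAt ℝ (timeInterval S) u :=
            (uniqueDiffOn_Icc (hu.1.trans_lt hu.2) u (Ico_subset_Icc_self hu)).mono hsubI
          rw [(hψd u hu' (by rw [hψu]; exact hsub h0mem)).derivWithin hud, hψu]
          linarith
      have hmem : ∀ u ∈ Icc 0 t, ψ u ∈ Ico 0 b := fun u hu => ⟨hnn u hu, hlt u hu⟩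
      refine ⟨hmem t ⟨ht.1, le_rfl⟩, ?_⟩
      have hdd : ∀ u ∈ Ico 0 t, HasDerivWithinAt (fun u => Ψ (ψ u)) 1 (Ici u) u := by
        intro u hu
        have hu' := hIco (hmem u (Ico_subset_Icc_self hu))
        have := (hΨd _ hu').hasDerivAt.comp_hasDerivWithinAt u
          (hder u (Ico_subset_Icc_self hu) hu.2 (hsub hu'))
        rwa [inv_mul_cancel₀ (hpos _ hu').ne'] at this
      have := eq_of_has_deriv_right_eq (f := fun u => Ψ (ψ u)) (g := fun u => u) (f' := fun _ => 1)
        hdd (fun u _ => hasDerivWithinAt_id u _)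
        (hΨc.comp hc fun u hu => hIco (hmem u hu)) continuousOn_id (by simp [hψ0, hΨ0])
      exact this t ⟨ht.1, le_rfl⟩
    constructor
    -- If the competitor lived beyond `T`, then `Ψ (ψ T) = T`, whereas all values of `Ψ` are below
    -- `T`.
    · by_contra hlt
      push Not at hlt
      obtain ⟨hm, he⟩ := key T ⟨hTpos.le, hlt⟩
      exact (hΨT _ (hIco hm)).ne he
    · intro t ht
      obtain ⟨hm, he⟩ := key t ht
      conv_rhs => rw [← he, hφΨ _ (hIco hm)]

end AutonomousODE

/-! ### Parameters of an isoparametric family -/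

section IsoparametricFamilies

variable {n g : ℕ} {M : Type*} [TopologicalSpace M] [ChartedSpace (EuclideanSpace ℝ (Fin n)) M]
  {P : MvPolynomial (Fin (n + 2)) ℝ} {f N : ℝ → M → Amb n} {τ σ : ℝ}

theorem natCast_pos_of_mem_Ioo (hτ : τ ∈ Ioo 0 (Real.pi / g)) : 0 < (g : ℝ) := by
  by_contra h
  have : (g : ℝ) = 0 := le_antisymm (not_lt.1 h) (Nat.cast_nonneg g)
  rw [this, div_zero] at hτ
  exact absurd hτ.1 hτ.2.not_gt

theorem pi_div_le_pi (hτ : τ ∈ Ioo 0 (Real.pi / g)) : Real.pi / g ≤ Real.pi := by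
  have hg : (1 : ℝ) ≤ g := by exact_mod_cast Nat.cast_pos.1 (natCast_pos_of_mem_Ioo hτ)
  exact div_le_self Real.pi_pos.le hg

theorem sin_natCast_mul_pos (hτ : τ ∈ Ioo 0 (Real.pi / g)) : 0 < Real.sin (g * τ) := by
  have hg := natCast_pos_of_mem_Ioo hτ
  refine Real.sin_pos_of_pos_of_lt_pi (mul_pos hg hτ.1) ?_
  have := hτ.2
  rwa [lt_div_iff₀ hg, mul_comm] at this

theorem mem_Ioo_arccos_div (hg : 0 < (g : ℝ)) {c : ℝ} (h1 : -1 < c) (h2 : c < 1) :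
    Real.arccos c / g ∈ Ioo 0 (Real.pi / g) := by
  refine ⟨div_pos (Real.arccos_pos.2 h2) hg, (div_lt_div_iff_of_pos_right hg).2 ?_⟩
  refine lt_of_le_of_ne (Real.arccos_le_pi c) fun h => ?_
  rw [Real.arccos_eq_pi] at h
  linarith

namespace IsOrientedHypersurface

variable {f N : M → Amb n}


theorem norm_eq (h : IsOrientedHypersurface f N) (p : M) : ‖f p‖ = 1 := by simpa using h.mem_sphere p

theorem mdifferentiableAt (h : IsOrientedHypersurface f N) (p : M) :
    MDifferentiableAt (𝓡 n) 𝓘(ℝ, Amb n) f p :=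
  (h.smooth p).mdifferentiableAt (by simp)

theorem mdifferentiableAt_normal (h : IsOrientedHypersurface f N) (p : M) :
    MDifferentiableAt (𝓡 n) 𝓘(ℝ, Amb n) N p :=
  (h.smooth_normal p).mdifferentiableAt (by simp)

end IsOrientedHypersurface

end IsoparametricFamilies

/-! ### The gradient of `P` and the first Cartan–Münzner equation -/

section IsoparametricGeometry

variable {n g : ℕ} {M : Type*} [TopologicalSpace M] [ChartedSpace (EuclideanSpace ℝ (Fin n)) M]

namespace IsOrientedHypersurface

variable {f N : M → Amb n}

theorem tangent_sphere (h : IsOrientedHypersurface f N) (p : M) (v : TangentSpace (𝓡 n) p) :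
    inner ℝ (f p) (mvfderiv (𝓡 n) f p v) = 0 := by
  have hG : HasFDerivAt (fun x : Amb n => ‖x‖ ^ 2) (2 • innerSL ℝ (f p)) (f p) :=
    (hasStrictFDerivAt_norm_sq (f p)).hasFDerivAt
  have h1 := mvfderiv_comp_of_differentiableAt hG.differentiableAt (h.mdifferentiableAt p) v
  have h2 := mvfderiv_eq_zero_of_forall_eq (f := fun q => ‖f q‖ ^ 2) (p := p) (c := 1)
    (fun q => by rw [h.norm_eq q, one_pow]) v
  have h3 := h1.symm.trans h2
  rw [hG.fderiv] at h3
  simpa using h3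

/-- The image of `df` has dimension `n` in a space of dimension `n + 2`, so its orthogonal
complement is a plane, already spanned by the orthonormal pair `f p`, `N p`. -/
theorem eq_zero_of_orthogonal (h : IsOrientedHypersurface f N) (p : M) {w : Amb n}
    (hf : inner ℝ w (f p) = 0) (hN : inner ℝ w (N p) = 0)
    (hd : ∀ v : TangentSpace (𝓡 n) p, inner ℝ w (mvfderiv (𝓡 n) f p v) = 0) : w = 0 := by
  let D : EuclideanSpace ℝ (Fin n) →ₗ[ℝ] Amb n := (mvfderiv (𝓡 n) f p).toLinearMap
  have hmem : ∀ x : Amb n, (∀ v, inner ℝ x (mvfderiv (𝓡 n) f p v) = 0) → x ∈ (D.range)ᗮ := by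
    intro x hx
    rw [Submodule.mem_orthogonal']
    rintro _ ⟨v, rfl⟩
    exact hx v
  have hrank : Module.finrank ℝ (D.range)ᗮ = 2 := by
    have h1 := Submodule.finrank_add_finrank_orthogonal D.range
    have h2 : Module.finrank ℝ D.range = Module.finrank ℝ (EuclideanSpace ℝ (Fin n)) :=
      LinearMap.finrank_range_of_inj (h.immersion p)
    rw [h2] at h1
    simp only [finrank_euclideanSpace_fin] at h1
    omega
  by_contra hw
  let b : Fin 3 → (D.range)ᗮ := ![⟨f p, hmem _ (h.tangent_sphere p)⟩,
    ⟨N p, hmem _ (h.normal_orthogonal p)⟩, ⟨w, hmem _ hd⟩]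
  have hb : LinearIndependent ℝ b := by
    have hne : ∀ x : Amb n, ‖x‖ = 1 → x ≠ 0 := by rintro x hx rfl; simp at hx
    have hNf := h.normal_tangent_sphere p
    refine linearIndependent_of_ne_zero_of_inner_eq_zero (𝕜 := ℝ) (fun i => ?_) fun i j hij => ?_
    · fin_cases i
      · exact fun h0 => hne _ (h.norm_eq p) (congrArg Subtype.val h0)
      · exact fun h0 => hne _ (h.norm_normal p) (congrArg Subtype.val h0)
      · exact fun h0 => hw (congrArg Subtype.val h0)
    · have hfN := (real_inner_comm (N p) (f p)).trans hNf
      have hfw := (real_inner_comm w (f p)).trans hf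
      have hNw := (real_inner_comm w (N p)).trans hN
      fin_cases i <;> fin_cases j <;> first | exact absurd rfl hij | assumption
  have := hb.fintype_card_le_finrank
  rw [hrank, Fintype.card_fin] at this
  omega

end IsOrientedHypersurface

namespace IsIsoparametricFamily

variable {P : MvPolynomial (Fin (n + 2)) ℝ} {f N : ℝ → M → Amb n} {τ σ : ℝ}

theorem polyFun_eq (hf : IsIsoparametricFamily g P f N) (hτ : τ ∈ Ioo 0 (Real.pi / g)) (p : M) :
    polyFun P (f τ p) = Real.cos (g * τ) := by
  have : f τ p ∈ sphereLevel P (Real.cos (g * τ)) := by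
    rw [← hf.range_eq τ hτ]; exact mem_range_self p
  exact this.2

theorem normal_eq (hf : IsIsoparametricFamily g P f N) (hτ : τ ∈ Ioo 0 (Real.pi / g))
    (hσ : σ ∈ Ioo 0 (Real.pi / g)) (p : M) :
    N σ p = sphereExpVelocity (f τ p) (N τ p) (τ - σ) := by
  -- Parallelism controls positions only. Reaching a third member `ρ` from both `τ` and `σ` gives
  -- two expressions whose normal parts carry the factor `sin (σ - ρ) ≠ 0`.
  obtain ⟨ρ, hρ0, hρσ⟩ := exists_between hσ.1
  have hρ : ρ ∈ Ioo 0 (Real.pi / g) := ⟨hρ0, hρσ.trans hσ.2⟩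
  have hpi := pi_div_le_pi hτ
  have hsin : Real.sin (σ - ρ) ≠ 0 :=
    (Real.sin_pos_of_pos_of_lt_pi (sub_pos.2 hρσ) (by linarith [hσ.2])).ne'
  have h1 := hf.parallel τ hτ ρ hρ p
  rw [hf.parallel σ hσ ρ hρ p, show τ - ρ = (τ - σ) + (σ - ρ) by ring, ← sphereExp_sphereExp,
    ← hf.parallel τ hτ σ hσ p] at h1
  simp only [sphereExp] at h1
  exact smul_right_injective _ hsin (add_left_cancel h1)

theorem norm_sphereExp (hf : IsIsoparametricFamily g P f N) (hτ : τ ∈ Ioo 0 (Real.pi / g)) (p : M)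
    (s : ℝ) : ‖sphereExp (f τ p) (N τ p) s‖ = 1 :=
  let h := hf.hypersurface τ hτ
  _root_.norm_sphereExp (h.norm_eq p) (h.norm_normal p) (h.normal_tangent_sphere p) s

theorem norm_sphereExpVelocity (hf : IsIsoparametricFamily g P f N)
    (hτ : τ ∈ Ioo 0 (Real.pi / g)) (p : M) (s : ℝ) :
    ‖sphereExpVelocity (f τ p) (N τ p) s‖ = 1 :=
  let h := hf.hypersurface τ hτ
  _root_.norm_sphereExpVelocity (h.norm_eq p) (h.norm_normal p) (h.normal_tangent_sphere p) s

theorem inner_sphereExpVelocity (hf : IsIsoparametricFamily g P f N)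
    (hτ : τ ∈ Ioo 0 (Real.pi / g)) (p : M) (s : ℝ) :
    inner ℝ (sphereExpVelocity (f τ p) (N τ p) s) (sphereExp (f τ p) (N τ p) s) = 0 :=
  let h := hf.hypersurface τ hτ
  inner_sphereExpVelocity_sphereExp (h.norm_eq p) (h.norm_normal p) (h.normal_tangent_sphere p) s

/-- Along the whole normal great circle the polynomial is the cosine of `g` times the distance to
the focal set. -/
theorem polyFun_sphereExp (hf : IsIsoparametricFamily g P f N) (hτ : τ ∈ Ioo 0 (Real.pi / g))
    (p : M) (s : ℝ) :
    polyFun P (sphereExp (f τ p) (N τ p) s) = Real.cos (g * (τ - s)) := by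
  -- For small `s` the circle stays inside the family, where the formula is the level set equation;
  -- analyticity in `s` does the rest.
  have h1 : AnalyticOnNhd ℝ (fun s => polyFun P (sphereExp (f τ p) (N τ p) s)) univ := by
    intro s _
    refine (analyticOnNhd_polyFun P _ trivial).comp ?_
    unfold sphereExp
    fun_prop
  have h2 : AnalyticOnNhd ℝ (fun s : ℝ => Real.cos (g * (τ - s))) univ := by
    intro s _
    fun_prop
  refine h1.eqOn_of_preconnected_of_eventuallyEq h2 isPreconnected_univ (mem_univ 0) ?_
    (mem_univ s)
  have hev : ∀ᶠ s in 𝓝 (0 : ℝ), τ - s ∈ Ioo 0 (Real.pi / g) := by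
    have hc : ContinuousAt (fun s : ℝ => τ - s) 0 := by fun_prop
    exact hc (isOpen_Ioo.mem_nhds (by simpa using hτ))
  filter_upwards [hev] with s hs
  have := hf.parallel τ hτ (τ - s) hs p
  rw [sub_sub_cancel] at this
  rw [← this, hf.polyFun_eq hs p]

theorem fderiv_polyFun_velocity (hf : IsIsoparametricFamily g P f N)
    (hτ : τ ∈ Ioo 0 (Real.pi / g)) (p : M) (s : ℝ) :
    fderiv ℝ (polyFun P) (sphereExp (f τ p) (N τ p) s) (sphereExpVelocity (f τ p) (N τ p) s)
      = g * Real.sin (g * (τ - s)) := by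
  have h1 := (differentiable_polyFun P _).hasFDerivAt.comp_hasDerivAt s
    (hasDerivAt_sphereExp (f τ p) (N τ p) s)
  have h2 : HasDerivAt (fun s : ℝ => Real.cos (g * (τ - s))) (g * Real.sin (g * (τ - s))) s := by
    have := (((hasDerivAt_id s).const_sub τ).const_mul (g : ℝ)).cos
    convert! this using 1
    simp only [id]
    ring
  have h3 : polyFun P ∘ sphereExp (f τ p) (N τ p) = fun s : ℝ => Real.cos (g * (τ - s)) :=
    funext fun s => hf.polyFun_sphereExp hτ p s
  rw [h3] at h1
  exact h1.unique h2

/-- Both sides have the same inner products with the position (Euler's identity), the normal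
(derivative of the cosine along the great circle) and the tangent vectors (`P` is constant on the
hypersurface). -/
theorem gradient_eq (hf : IsIsoparametricFamily g P f N) (hτ : τ ∈ Ioo 0 (Real.pi / g)) (p : M) :
    gradient (polyFun P) (f τ p)
      = (g * Real.cos (g * τ)) • f τ p + (g * Real.sin (g * τ)) • N τ p := by
  have h := hf.hypersurface τ hτ
  have hff : inner ℝ (f τ p) (f τ p) = 1 := by
    rw [real_inner_self_eq_norm_sq, h.norm_eq, one_pow]
  have hNN : inner ℝ (N τ p) (N τ p) = 1 := by
    rw [real_inner_self_eq_norm_sq, h.norm_normal, one_pow]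
  have hNf := h.normal_tangent_sphere p
  have hfN := (real_inner_comm (N τ p) (f τ p)).trans hNf
  have hvel := hf.fderiv_polyFun_velocity hτ p 0
  rw [sphereExp_zero, sphereExpVelocity_zero, sub_zero] at hvel
  rw [← sub_eq_zero]
  refine h.eq_zero_of_orthogonal p ?_ ?_ fun v => ?_
  · rw [inner_sub_left, inner_gradient_polyFun, fderiv_polyFun_self hf.homogeneous,
      hf.polyFun_eq hτ, inner_add_left, real_inner_smul_left, real_inner_smul_left, hff, hNf]
    ring
  · rw [inner_sub_left, inner_gradient_polyFun, hvel, inner_add_left, real_inner_smul_left,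
      real_inner_smul_left, hNN, hfN]
    ring
  · have h1 := mvfderiv_comp_of_differentiableAt (differentiable_polyFun P (f τ p))
      (h.mdifferentiableAt p) v
    have h2 := mvfderiv_eq_zero_of_forall_eq (f := fun q => polyFun P (f τ q)) (p := p)
      (c := Real.cos (g * τ)) (fun q => hf.polyFun_eq hτ q) v
    rw [inner_sub_left, inner_gradient_polyFun, ← h1, h2, inner_add_left, real_inner_smul_left,
      real_inner_smul_left, h.tangent_sphere, h.normal_orthogonal]
    ring

theorem norm_sq_gradient_eq (hf : IsIsoparametricFamily g P f N)
    (hτ : τ ∈ Ioo 0 (Real.pi / g)) (p : M) : ‖gradient (polyFun P) (f τ p)‖ ^ 2 = g ^ 2 := by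
  have h := hf.hypersurface τ hτ
  rw [hf.gradient_eq hτ, norm_add_sq_real, norm_smul, norm_smul, h.norm_eq, h.norm_normal,
    real_inner_smul_left, real_inner_smul_right, real_inner_comm, h.normal_tangent_sphere]
  simp only [Real.norm_eq_abs, mul_one, sq_abs]
  nlinarith [Real.sin_sq_add_cos_sq (g * τ)]

theorem exists_eq_of_polyFun_mem_Ioo (hf : IsIsoparametricFamily g P f N) (hg : 0 < (g : ℝ))
    {x : Amb n} (hx : ‖x‖ = 1) (h1 : -1 < polyFun P x) (h2 : polyFun P x < 1) :
    ∃ p, f (Real.arccos (polyFun P x) / g) p = x := by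
  have : x ∈ sphereLevel P (Real.cos (g * (Real.arccos (polyFun P x) / g))) := by
    refine ⟨by simpa using hx, ?_⟩
    rw [mul_div_cancel₀ _ hg.ne', Real.cos_arccos h1.le h2.le]
    rfl
  rwa [← hf.range_eq _ (mem_Ioo_arccos_div hg h1 h2)] at this

theorem polyFun_sq_lt_one (hf : IsIsoparametricFamily g P f N) (hτ : τ ∈ Ioo 0 (Real.pi / g))
    (p : M) : polyFun P (f τ p) ^ 2 < 1 := by
  rw [hf.polyFun_eq hτ]
  nlinarith [Real.sin_sq_add_cos_sq (g * τ), sin_natCast_mul_pos hτ]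

/-- The first Cartan–Münzner differential equation. -/
theorem norm_sq_gradient [Nonempty M] (hf : IsIsoparametricFamily g P f N)
    (hτ : τ ∈ Ioo 0 (Real.pi / g)) (x : Amb n) :
    ‖gradient (polyFun P) x‖ ^ 2 = g ^ 2 * (‖x‖ ^ 2) ^ (g - 1) := by
  have hg := natCast_pos_of_mem_Ioo hτ
  have hg0 : g ≠ 0 := by rintro rfl; simp at hg
  obtain ⟨p⟩ := ‹Nonempty M›
  have h1 : AnalyticOnNhd ℝ (fun x : Amb n => inner ℝ (gradient (polyFun P) x)
      (gradient (polyFun P) x)) univ := fun x _ =>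
    ((innerSL ℝ : Amb n →L[ℝ] Amb n →L[ℝ] ℝ).analyticAt_bilinear _).comp₂
      (analyticOnNhd_gradient_polyFun P x trivial) (analyticOnNhd_gradient_polyFun P x trivial)
  have h2 : AnalyticOnNhd ℝ (fun x : Amb n => (g : ℝ) ^ 2 * (inner ℝ x x) ^ (g - 1)) univ :=
    fun x _ => analyticAt_const.mul
      ((((innerSL ℝ : Amb n →L[ℝ] Amb n →L[ℝ] ℝ).analyticAt_bilinear _).comp₂
        analyticAt_id analyticAt_id).pow _)
  -- Near `f τ p` every point projects radially to a regular point of the sphere, where the gradient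
  -- has norm `g`; homogeneity scales this back.
  have h3 : ∀ᶠ x in 𝓝 (f τ p), inner ℝ (gradient (polyFun P) x) (gradient (polyFun P) x)
      = (g : ℝ) ^ 2 * (inner ℝ x x) ^ (g - 1) := by
    have hopen : IsOpen {x : Amb n | polyFun P x ^ 2 < (‖x‖ ^ 2) ^ g} :=
      isOpen_lt ((continuous_polyFun P).pow 2) (by fun_prop)
    have hmem : f τ p ∈ {x : Amb n | polyFun P x ^ 2 < (‖x‖ ^ 2) ^ g} := by
      simpa [(hf.hypersurface τ hτ).norm_eq] using hf.polyFun_sq_lt_one hτ p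
    filter_upwards [hopen.mem_nhds hmem] with x hx
    have hx0 : ‖x‖ ≠ 0 := by
      intro h0
      rw [h0] at hx
      simp only [ne_eq, OfNat.ofNat_ne_zero, not_false_eq_true, zero_pow, hg0] at hx
      exact absurd hx (not_lt.2 (sq_nonneg _))
    set u : Amb n := ‖x‖⁻¹ • x with hu
    have hxu : x = ‖x‖ • u := by rw [hu, smul_smul, mul_inv_cancel₀ hx0, one_smul]
    have hun : ‖u‖ = 1 := by rw [hu, norm_smul, norm_inv, norm_norm, inv_mul_cancel₀ hx0]
    have hPu : polyFun P u ^ 2 < 1 := by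
      rw [hxu, polyFun_smul hf.homogeneous, norm_smul, hun, norm_norm, mul_one,
        mul_pow, ← pow_mul, ← pow_mul, mul_comm g 2] at hx
      have : 0 < ‖x‖ ^ (2 * g) := by positivity
      nlinarith
    obtain ⟨hl, hr⟩ := abs_lt.1 ((sq_lt_one_iff_abs_lt_one _).1 hPu)
    obtain ⟨q, hq⟩ := hf.exists_eq_of_polyFun_mem_Ioo hg hun hl hr
    rw [real_inner_self_eq_norm_sq, real_inner_self_eq_norm_sq]
    conv_lhs => rw [hxu, gradient_polyFun_smul hf.homogeneous hg0 hx0, norm_smul, mul_pow, ← hq,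
      hf.norm_sq_gradient_eq (mem_Ioo_arccos_div hg hl hr), norm_pow, norm_norm]
    ring
  have h4 := h1.eqOn_of_preconnected_of_eventuallyEq h2 isPreconnected_univ (mem_univ (f τ p)) h3
    (mem_univ x)
  simpa only [real_inner_self_eq_norm_sq] using h4

theorem norm_gradient [Nonempty M] (hf : IsIsoparametricFamily g P f N)
    (hτ : τ ∈ Ioo 0 (Real.pi / g)) {x : Amb n} (hx : ‖x‖ = 1) :
    ‖gradient (polyFun P) x‖ = g := by
  have := hf.norm_sq_gradient hτ x
  rw [hx, one_pow, one_pow, mul_one] at this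
  exact (sq_eq_sq₀ (norm_nonneg _) (Nat.cast_nonneg g)).1 this

/-- Cauchy–Schwarz applied to Euler's identity `⟨∇P, x⟩ = g P(x)`, with `|∇P| = g`. -/
theorem abs_polyFun_le_one [Nonempty M] (hf : IsIsoparametricFamily g P f N)
    (hτ : τ ∈ Ioo 0 (Real.pi / g)) {x : Amb n} (hx : ‖x‖ = 1) : |polyFun P x| ≤ 1 := by
  have hg := natCast_pos_of_mem_Ioo hτ
  have h := abs_real_inner_le_norm (gradient (polyFun P) x) x
  rw [inner_gradient_polyFun, fderiv_polyFun_self hf.homogeneous, hf.norm_gradient hτ hx, hx,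
    abs_mul, Nat.abs_cast] at h
  exact le_of_mul_le_mul_left h hg

/-- The gradient of the polynomial along the whole normal great circle. -/
theorem gradient_sphereExp [Nonempty M] (hf : IsIsoparametricFamily g P f N)
    (hτ : τ ∈ Ioo 0 (Real.pi / g)) (p : M) (s : ℝ) :
    gradient (polyFun P) (sphereExp (f τ p) (N τ p) s)
      = (g * Real.cos (g * (τ - s))) • sphereExp (f τ p) (N τ p) s
        + (g * Real.sin (g * (τ - s))) • sphereExpVelocity (f τ p) (N τ p) s := by
  have hF := hf.norm_sphereExp hτ p s
  have hV := hf.norm_sphereExpVelocity hτ p s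
  have hVF := hf.inner_sphereExpVelocity hτ p s
  have hgr := hf.norm_gradient hτ hF
  have h1 := fderiv_polyFun_self hf.homogeneous (sphereExp (f τ p) (N τ p) s)
  have h2 := hf.fderiv_polyFun_velocity hτ p s
  rw [hf.polyFun_sphereExp hτ] at h1
  rw [← inner_gradient_polyFun] at h1 h2
  set F := sphereExp (f τ p) (N τ p) s
  set V := sphereExpVelocity (f τ p) (N τ p) s
  set G := gradient (polyFun P) F
  -- The components of `G` along the orthonormal pair `F`, `V` already account for its full squared
  -- length `g²`, so nothing remains in other directions. No immersion property is needed here.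
  rw [← sub_eq_zero, ← norm_eq_zero, ← sq_eq_zero_iff, norm_sub_sq_real, norm_add_sq_real,
    norm_smul, norm_smul, hF, hV, hgr, inner_add_right, real_inner_smul_right,
    real_inner_smul_right, h1, h2, real_inner_smul_left, real_inner_smul_right,
    real_inner_comm, hVF]
  simp only [Real.norm_eq_abs, mul_one, sq_abs]
  have := Real.sin_sq_add_cos_sq (g * (τ - s))
  linear_combination (-(g : ℝ) ^ 2) * this

end IsIsoparametricFamily

end IsoparametricGeometry

/-! ### Principal curvatures and focal maps -/

section FocalSets

variable {n g : ℕ} {M : Type*} [TopologicalSpace M] [ChartedSpace (EuclideanSpace ℝ (Fin n)) M]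

namespace IsOrientedHypersurface

variable {f N : M → Amb n} {k : Fin n → ℝ}

theorem mvfderiv_sphereExp (h : IsOrientedHypersurface f N) (s : ℝ) (p : M)
    (v : TangentSpace (𝓡 n) p) :
    mvfderiv (𝓡 n) (fun q => sphereExp (f q) (N q) s) p v
      = Real.cos s • mvfderiv (𝓡 n) f p v + Real.sin s • mvfderiv (𝓡 n) N p v :=
  mvfderiv_lincomb (h.mdifferentiableAt p) (h.mdifferentiableAt_normal p) _ _ v

theorem mvfderiv_sphereExpVelocity (h : IsOrientedHypersurface f N) (s : ℝ) (p : M)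
    (v : TangentSpace (𝓡 n) p) :
    mvfderiv (𝓡 n) (fun q => sphereExpVelocity (f q) (N q) s) p v
      = Real.cos s • mvfderiv (𝓡 n) N p v - Real.sin s • mvfderiv (𝓡 n) f p v := by
  have h1 := mvfderiv_lincomb (h.mdifferentiableAt_normal p) (h.mdifferentiableAt p)
    (Real.cos s) (-Real.sin s) v
  have h2 : (fun q => sphereExpVelocity (f q) (N q) s)
      = fun q => Real.cos s • N q + (-Real.sin s) • f q := by
    funext q; simp only [sphereExpVelocity]; module
  rw [h2, h1]; module

theorem contMDiff_sphereExp (h : IsOrientedHypersurface f N) (s : ℝ) :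
    ContMDiff (𝓡 n) 𝓘(ℝ, Amb n) ∞ (fun q => sphereExp (f q) (N q) s) :=
  ((by unfold sphereExp; fun_prop :
    ContDiff ℝ ∞ fun x : Amb n × Amb n => sphereExp x.1 x.2 s).contMDiff).comp
    (h.smooth.prodMk_space h.smooth_normal)

theorem mvfderiv_sphereExp_eigenvector (h : IsOrientedHypersurface f N) {p : M}
    {v : TangentSpace (𝓡 n) p} {κ : ℝ}
    (hv : mvfderiv (𝓡 n) N p v = -κ • mvfderiv (𝓡 n) f p v) (s : ℝ) :
    mvfderiv (𝓡 n) (fun q => sphereExp (f q) (N q) s) p v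
      = (Real.cos s - κ * Real.sin s) • mvfderiv (𝓡 n) f p v := by
  rw [h.mvfderiv_sphereExp, hv]; module

theorem mvfderiv_sphereExpVelocity_eigenvector (h : IsOrientedHypersurface f N) {p : M}
    {v : TangentSpace (𝓡 n) p} {κ : ℝ}
    (hv : mvfderiv (𝓡 n) N p v = -κ • mvfderiv (𝓡 n) f p v) (s : ℝ) :
    mvfderiv (𝓡 n) (fun q => sphereExpVelocity (f q) (N q) s) p v
      = -(κ * Real.cos s + Real.sin s) • mvfderiv (𝓡 n) f p v := by
  rw [h.mvfderiv_sphereExpVelocity, hv]; module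

theorem not_injective_of_cos_eq (h : IsOrientedHypersurface f N) {p : M}
    (hk : HasPrincipalCurvatures f N p k) {i : Fin n} {s : ℝ}
    (hs : Real.cos s = k i * Real.sin s) :
    ¬ Function.Injective (mvfderiv (𝓡 n) (fun q => sphereExp (f q) (N q) s) p) := by
  obtain ⟨b, hb⟩ := hk
  intro hinj
  refine b.ne_zero i (hinj ?_)
  rw [map_zero, h.mvfderiv_sphereExp_eigenvector (hb i), hs, sub_self, zero_smul]

end IsOrientedHypersurface

namespace IsIsoparametricFamily

variable {P : MvPolynomial (Fin (n + 2)) ℝ} {f N : ℝ → M → Amb n} {τ σ : ℝ}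

/-- The parallel maps are immersions except at the multiples of `π / g`. -/
theorem sin_eq_zero_of_mvfderiv_eq_zero [Nonempty M] (hf : IsIsoparametricFamily g P f N)
    (hτ : τ ∈ Ioo 0 (Real.pi / g)) {p : M} {v : TangentSpace (𝓡 n) p} (hv : v ≠ 0) {s : ℝ}
    (hs : mvfderiv (𝓡 n) (fun q => sphereExp (f τ q) (N τ q) s) p v = 0) :
    Real.sin (g * (τ - s)) = 0 := by
  by_contra hsin
  have hg := natCast_pos_of_mem_Ioo hτ
  have h := hf.hypersurface τ hτ
  set c := g * Real.cos (g * (τ - s)) with hc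
  set d := g * Real.sin (g * (τ - s)) with hd
  have hd0 : d ≠ 0 := mul_ne_zero hg.ne' hsin
  -- As the sine does not vanish, the velocity is a differentiable function `G` of the position, so
  -- a vector killed by the differential of the position is killed by that of the velocity.
  let G : Amb n → Amb n := fun x => d⁻¹ • (gradient (polyFun P) x - c • x)
  have hG : Differentiable ℝ G :=
    ((differentiable_gradient_polyFun P).sub (differentiable_id.const_smul c)).const_smul d⁻¹
  have hV : (fun q => sphereExpVelocity (f τ q) (N τ q) s)
      = fun q => G (sphereExp (f τ q) (N τ q) s) := by
    funext q
    simp only [G]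
    rw [hf.gradient_sphereExp hτ, add_sub_cancel_left, smul_smul, inv_mul_cancel₀ hd0, one_smul]
  have hF : MDifferentiableAt (𝓡 n) 𝓘(ℝ, Amb n) (fun q => sphereExp (f τ q) (N τ q) s) p :=
    (h.contMDiff_sphereExp s p).mdifferentiableAt (by simp)
  have h1 : mvfderiv (𝓡 n) (fun q => sphereExpVelocity (f τ q) (N τ q) s) p v = 0 := by
    rw [hV]
    refine (mvfderiv_comp_of_differentiableAt (hG _) hF v).trans ?_
    rw [hs, map_zero]
  rw [h.mvfderiv_sphereExp] at hs
  rw [h.mvfderiv_sphereExpVelocity] at h1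
  -- Rotating back by the angle `s` recovers `f τ` from position and velocity.
  have h2 : mvfderiv (𝓡 n) (f τ) p v = 0 := by
    have e : mvfderiv (𝓡 n) (f τ) p v
        = Real.cos s • (Real.cos s • mvfderiv (𝓡 n) (f τ) p v
            + Real.sin s • mvfderiv (𝓡 n) (N τ) p v)
          - Real.sin s • (Real.cos s • mvfderiv (𝓡 n) (N τ) p v
            - Real.sin s • mvfderiv (𝓡 n) (f τ) p v)
          + (1 - (Real.sin s ^ 2 + Real.cos s ^ 2)) • mvfderiv (𝓡 n) (f τ) p v := by module
    rw [e, hs, h1, Real.sin_sq_add_cos_sq]; simp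
  exact hv (h.immersion p (h2.trans (map_zero _).symm))

theorem _root_.Real.cot_add_int_mul_pi (x : ℝ) (m : ℤ) :
    Real.cot (x + m * Real.pi) = Real.cot x := by
  rw [Real.cot_eq_cos_div_sin, Real.cot_eq_cos_div_sin, Real.cos_add_int_mul_pi,
    Real.sin_add_int_mul_pi, mul_div_mul_left _ _ (zpow_ne_zero _ (by norm_num))]

/-- If `k i = cot α`, the parallel map at distance `α` kills the eigenvector, which forces `α` to
differ from `τ` by a multiple of `π / g`. -/
theorem exists_curvature_eq_cot [Nonempty M] (hf : IsIsoparametricFamily g P f N)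
    (hτ : τ ∈ Ioo 0 (Real.pi / g)) {p : M} {k : Fin n → ℝ}
    (hk : HasPrincipalCurvatures (f τ) (N τ) p k) (i : Fin n) :
    ∃ m : ℤ, k i = Real.cot (τ + m * (Real.pi / g)) := by
  obtain ⟨b, hb⟩ := hk
  have hg := natCast_pos_of_mem_Ioo hτ
  have h := hf.hypersurface τ hτ
  set α := Real.pi / 2 - Real.arctan (k i) with hα
  have hcos : Real.cos α = k i * Real.sin α := by
    rw [hα, Real.cos_pi_div_two_sub, Real.sin_pi_div_two_sub, Real.sin_arctan, Real.cos_arctan]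
    ring
  have hsin : Real.sin α ≠ 0 := by
    rw [hα, Real.sin_pi_div_two_sub]; exact (Real.cos_arctan_pos _).ne'
  have hs := hf.sin_eq_zero_of_mvfderiv_eq_zero hτ (b.ne_zero i) (s := α)
    (by rw [h.mvfderiv_sphereExp_eigenvector (hb i), hcos, sub_self, zero_smul])
  obtain ⟨m, hm⟩ := Real.sin_eq_zero_iff.1 hs
  refine ⟨-m, ?_⟩
  have : τ + ((-m : ℤ) : ℝ) * (Real.pi / g) = α := by
    push_cast
    field_simp
    linarith
  rw [this, Real.cot_eq_cos_div_sin, hcos, mul_div_cancel_right₀ _ hsin]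

/-- Since there are exactly `g` distinct principal curvatures, every number `cot (τ + m π / g)` is
one of them. -/
theorem exists_curvature_index [Nonempty M] (hf : IsIsoparametricFamily g P f N)
    (hτ : τ ∈ Ioo 0 (Real.pi / g)) {k : Fin n → ℝ}
    (hk : ∀ p, HasPrincipalCurvatures (f τ) (N τ) p k) (hcard : (range k).ncard = g) (m : ℤ) :
    ∃ i, k i = Real.cot (τ + m * (Real.pi / g)) := by
  classical
  obtain ⟨p⟩ := ‹Nonempty M›
  have hg := natCast_pos_of_mem_Ioo hτ
  have hgz : (0 : ℤ) < g := by exact_mod_cast hg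
  -- By the period `π` of the cotangent, only `m` modulo `g` matters.
  have hred : ∀ m : ℤ, Real.cot (τ + m * (Real.pi / g))
      = Real.cot (τ + ((m % g).toNat : ℕ) * (Real.pi / g)) := by
    intro m
    have h1 : ((m % g).toNat : ℤ) = m % g := Int.toNat_of_nonneg (Int.emod_nonneg m hgz.ne')
    have h2 : (((m % g).toNat : ℕ) : ℝ) = ((m % g : ℤ) : ℝ) := by exact_mod_cast h1
    have h3 : (m : ℝ) = (m % g : ℤ) + g * (m / g : ℤ) := by
      exact_mod_cast (Int.emod_add_mul_ediv m g).symm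
    refine Eq.trans (congrArg Real.cot ?_) (Real.cot_add_int_mul_pi _ (m / g))
    rw [h2, h3]
    field_simp
    ring
  have hlt : ∀ m : ℤ, (m % g).toNat ∈ Finset.range g := by
    intro m
    rw [Finset.mem_range]
    have := Int.emod_lt_of_pos m hgz
    have := Int.emod_nonneg m hgz.ne'
    omega
  set A : Finset ℝ := (Finset.range g).image fun j : ℕ => Real.cot (τ + j * (Real.pi / g)) with hA
  have hsub : Finset.univ.image k ⊆ A := by
    intro c hc
    obtain ⟨i, -, rfl⟩ := Finset.mem_image.1 hc
    obtain ⟨m, hm⟩ := hf.exists_curvature_eq_cot hτ (hk p) i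
    exact Finset.mem_image.2 ⟨_, hlt m, by rw [hm, hred]⟩
  have hc : (Finset.univ.image k).card = g := by
    rw [← hcard, ← Set.ncard_coe_finset, Finset.coe_image, Finset.coe_univ, image_univ]
  have heq := Finset.eq_of_subset_of_card_le hsub
    (by rw [hc]; exact Finset.card_image_le.trans (Finset.card_range g).le)
  have hm : Real.cot (τ + m * (Real.pi / g)) ∈ A := Finset.mem_image.2 ⟨_, hlt m, (hred m).symm⟩
  rw [← heq] at hm
  obtain ⟨i, -, hi⟩ := Finset.mem_image.1 hm
  exact ⟨i, hi⟩

/-- The map onto a focal set is nowhere an immersion. -/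
theorem not_injective_focalMap [Nonempty M] (hf : IsIsoparametricFamily g P f N)
    (hτ : τ ∈ Ioo 0 (Real.pi / g)) (m : ℤ) (p : M) :
    ¬ Function.Injective (mvfderiv (𝓡 n)
      (fun q => sphereExp (f τ q) (N τ q) (τ - m * (Real.pi / g))) p) := by
  obtain ⟨k, hk, hcard⟩ := hf.isoparametric τ hτ
  obtain ⟨i, hi⟩ := hf.exists_curvature_index hτ hk hcard (-m)
  refine (hf.hypersurface τ hτ).not_injective_of_cos_eq (hk p) (i := i) ?_
  have hg := natCast_pos_of_mem_Ioo hτ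
  have e : τ + ((-m : ℤ) : ℝ) * (Real.pi / g) = τ - m * (Real.pi / g) := by push_cast; ring
  rw [e, Real.cot_eq_cos_div_sin] at hi
  -- Otherwise `g τ` would be an integer multiple of `π`.
  have hsin : Real.sin (τ - m * (Real.pi / g)) ≠ 0 := by
    intro h0
    obtain ⟨j, hj⟩ := Real.sin_eq_zero_iff.1 h0
    have h1 := sin_natCast_mul_pos hτ
    have h2 : g * τ = ((g * j + m : ℤ) : ℝ) * Real.pi := by
      have : τ = j * Real.pi + m * (Real.pi / g) := by linarith
      rw [this]; push_cast; field_simp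
    rw [h2, Real.sin_int_mul_pi] at h1
    exact h1.false
  rw [hi, div_mul_cancel₀ _ hsin]

/-- If only points with `P = ±1` lay near `x` on the sphere, then `P² = |y|^(2g)` would hold on an
open set by homogeneity, hence everywhere by analyticity, contradicting the regular level `f τ`. -/
theorem mem_closure_regular [Nonempty M] (hf : IsIsoparametricFamily g P f N)
    (hτ : τ ∈ Ioo 0 (Real.pi / g)) {x : Amb n} (hx : ‖x‖ = 1) :
    x ∈ closure {y : Amb n | ‖y‖ = 1 ∧ -1 < polyFun P y ∧ polyFun P y < 1} := by
  by_contra hcl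
  obtain ⟨p⟩ := ‹Nonempty M›
  have hx0 : x ≠ 0 := by rintro rfl; simp at hx
  have hev : ∀ᶠ y in 𝓝 x, y ∉ {y : Amb n | ‖y‖ = 1 ∧ -1 < polyFun P y ∧ polyFun P y < 1} :=
    by_contra fun h => hcl (mem_closure_iff_frequently.2 fun h' => h h')
  have hc : ContinuousAt (fun y : Amb n => ‖y‖⁻¹ • y) x :=
    (continuous_norm.continuousAt.inv₀ (norm_ne_zero_iff.2 hx0)).smul continuousAt_id
  have hxx : ‖x‖⁻¹ • x = x := by rw [hx, inv_one, one_smul]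
  have hev' : (fun y => polyFun P y ^ 2) =ᶠ[𝓝 x] fun y : Amb n => (inner ℝ y y) ^ g := by
    have h1 : Tendsto (fun y : Amb n => ‖y‖⁻¹ • y) (𝓝 x) (𝓝 x) := by
      have := hc.tendsto
      rwa [hxx] at this
    filter_upwards [h1.eventually hev, isOpen_ne.mem_nhds hx0] with y hy hy0
    have hyn : ‖y‖ ≠ 0 := norm_ne_zero_iff.2 hy0
    have hun : ‖‖y‖⁻¹ • y‖ = 1 := by rw [norm_smul, norm_inv, norm_norm, inv_mul_cancel₀ hyn]
    have hle := abs_le.1 (hf.abs_polyFun_le_one hτ hun)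
    have hsq : polyFun P (‖y‖⁻¹ • y) ^ 2 = 1 := by
      rcases lt_or_ge (-1) (polyFun P (‖y‖⁻¹ • y)) with h' | h'
      · rw [le_antisymm hle.2 (not_lt.1 fun h'' => hy ⟨hun, h', h''⟩), one_pow]
      · rw [le_antisymm h' hle.1]; norm_num
    rw [real_inner_self_eq_norm_sq]
    have : y = ‖y‖ • (‖y‖⁻¹ • y) := by rw [smul_smul, mul_inv_cancel₀ hyn, one_smul]
    conv_lhs => rw [this, polyFun_smul hf.homogeneous, mul_pow, hsq]
    ring
  have h1 : AnalyticOnNhd ℝ (fun y => polyFun P y ^ 2) univ := (analyticOnNhd_polyFun P).pow 2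
  have h2 : AnalyticOnNhd ℝ (fun x : Amb n => (inner ℝ x x) ^ g) univ :=
    fun x _ => (((innerSL ℝ : Amb n →L[ℝ] Amb n →L[ℝ] ℝ).analyticAt_bilinear _).comp₂
        analyticAt_id analyticAt_id).pow _
  have h3 := h1.eqOn_of_preconnected_of_eventuallyEq h2 isPreconnected_univ (mem_univ x) hev'
    (mem_univ (f τ p))
  simp only [real_inner_self_eq_norm_sq, (hf.hypersurface τ hτ).norm_eq, one_pow] at h3
  exact (hf.polyFun_sq_lt_one hτ p).ne h3

theorem isCompact_sphereLevel (P : MvPolynomial (Fin (n + 2)) ℝ) (c : ℝ) :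
    IsCompact (sphereLevel P c) :=
  (isCompact_sphere (0 : Amb n) 1).inter_right (isClosed_eq (continuous_polyFun P) continuous_const)

/-- Compactness comes from the level set, not from `M`: by `gradient_eq` the normal is a continuous
function of the position. -/
theorem isCompact_range_sphereExp (hf : IsIsoparametricFamily g P f N)
    (hτ : τ ∈ Ioo 0 (Real.pi / g)) (s : ℝ) :
    IsCompact (range fun q => sphereExp (f τ q) (N τ q) s) := by
  have hd0 : g * Real.sin (g * τ) ≠ 0 :=
    mul_ne_zero (natCast_pos_of_mem_Ioo hτ).ne' (sin_natCast_mul_pos hτ).ne'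
  let G : Amb n → Amb n := fun x => Real.cos s • x + Real.sin s •
    ((g * Real.sin (g * τ))⁻¹ • (gradient (polyFun P) x - (g * Real.cos (g * τ)) • x))
  have hG : Continuous G := by
    have := (differentiable_gradient_polyFun P).continuous
    fun_prop
  have : (fun q => sphereExp (f τ q) (N τ q) s) = G ∘ f τ := by
    funext q
    simp only [G, Function.comp, sphereExp]
    rw [hf.gradient_eq hτ, add_sub_cancel_left, inv_smul_smul₀ hd0]
  rw [this, range_comp, hf.range_eq τ hτ]
  exact (isCompact_sphereLevel P _).image hG

/-- The normal great circles reach the whole of both focal sets. -/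
theorem range_focalMap [Nonempty M] (hf : IsIsoparametricFamily g P f N)
    (hτ : τ ∈ Ioo 0 (Real.pi / g)) {c : ℝ} (hc : -1 ≤ c) (hc' : c ≤ 1) :
    (range fun q => sphereExp (f τ q) (N τ q) (τ - Real.arccos c / g)) = sphereLevel P c := by
  have hg := natCast_pos_of_mem_Ioo hτ
  set e := Real.arccos c / g with he
  refine subset_antisymm ?_ fun x hx => ?_
  · rintro _ ⟨q, rfl⟩
    refine ⟨by simpa using hf.norm_sphereExp hτ q _, ?_⟩
    refine (hf.polyFun_sphereExp hτ q _).trans ?_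
    rw [sub_sub_cancel, he, mul_div_cancel₀ _ hg.ne', Real.cos_arccos hc hc']
  · have hxn : ‖x‖ = 1 := by simpa using hx.1
    have hPx : polyFun P x = c := hx.2
    rw [← (hf.isCompact_range_sphereExp hτ (τ - e)).isClosed.closure_eq, Metric.mem_closure_iff]
    intro ε hε
    let a : Amb n → ℝ := fun y => Real.arccos (polyFun P y) / g - e
    have hac : Continuous a :=
      ((Real.continuous_arccos.comp (continuous_polyFun P)).div_const _).sub continuous_const
    -- `D y` bounds the distance from `x` to the point reached from a regular `y` along its normal
    -- circle; the length travelled, `a y`, tends to `0` as `y` tends to `x`.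
    let D : Amb n → ℝ := fun y => dist x y + (|1 - Real.cos (a y)| + |0 - Real.sin (a y)|)
    have hD : Continuous D := by fun_prop
    have hDx : D x = 0 := by simp [D, a, hPx, he]
    have hopen : IsOpen {y | D y < ε} := isOpen_lt hD continuous_const
    obtain ⟨y, hyD, hyn, hy1, hy2⟩ := mem_closure_iff.1 (hf.mem_closure_regular hτ hxn) _ hopen
      (by rw [mem_ofPred_eq, hDx]; exact hε)
    obtain ⟨q, hq⟩ := hf.exists_eq_of_polyFun_mem_Ioo hg hyn hy1 hy2
    refine ⟨_, mem_range_self q, ?_⟩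
    have hσ := mem_Ioo_arccos_div hg hy1 hy2
    set σ := Real.arccos (polyFun P y) / g with hσdef
    have h1 : sphereExp (f τ q) (N τ q) (τ - e) = sphereExp (f σ q) (N σ q) (σ - e) := by
      rw [hf.parallel τ hτ σ hσ, hf.normal_eq hτ hσ, sphereExp_sphereExp, sub_add_sub_cancel]
    have h2 := norm_sphereExp_sub_le ((hf.hypersurface σ hσ).norm_eq q)
      ((hf.hypersurface σ hσ).norm_normal q) 0 (σ - e)
    rw [sphereExp_zero, hq, Real.cos_zero, Real.sin_zero, ← dist_eq_norm] at h2
    calc dist x _ ≤ dist x y + dist y (sphereExp (f τ q) (N τ q) (τ - e)) := dist_triangle _ _ _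
      _ ≤ D y := by
        rw [h1, hq]
        exact add_le_add le_rfl h2
      _ < ε := hyD

end IsIsoparametricFamily

end FocalSets

/-! ### Reduction of parallel flows to the scalar equation -/

section ParallelFlows

variable {n g : ℕ} {M : Type*} [TopologicalSpace M] [ChartedSpace (EuclideanSpace ℝ (Fin n)) M]

/-- The principal curvatures of the parallel hypersurface at the signed distance `s`. -/
noncomputable def parallelCurvatures (k : Fin n → ℝ) (s : ℝ) : Fin n → ℝ :=
  fun i => (k i * Real.cos s + Real.sin s) / (Real.cos s - k i * Real.sin s)

namespace IsOrientedHypersurface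

variable {f N : M → Amb n} {k : Fin n → ℝ}

theorem exists_perm_principalCurvatures (h : IsOrientedHypersurface f N) {p : M}
    (hk : HasPrincipalCurvatures f N p k) :
    ∃ σ : Equiv.Perm (Fin n), principalCurvatures f N p ∘ σ = k := by
  have hex : ∃ k, HasPrincipalCurvatures f N p k := ⟨k, hk⟩
  rw [principalCurvatures, dif_pos hex]
  obtain ⟨c, hc⟩ := hex.choose_spec
  obtain ⟨b, hb⟩ := hk
  exact exists_perm_of_relative_eigenbases (D := (mvfderiv (𝓡 n) f p).toLinearMap)
    (B := (mvfderiv (𝓡 n) N p).toLinearMap) (h.immersion p) hb hc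

end IsOrientedHypersurface

namespace IsIsoparametricFamily

variable {P : MvPolynomial (Fin (n + 2)) ℝ} {f N : ℝ → M → Amb n} {τ σ : ℝ} {k : Fin n → ℝ}
  {Γ : Set (Fin n → ℝ)} {W : (Fin n → ℝ) → ℝ}

/-- This is the factor by which the differential is scaled on an eigenvector, and `f (τ - s)` is an
immersion. -/
theorem cos_sub_mul_sin_ne_zero (hf : IsIsoparametricFamily g P f N)
    (hτ : τ ∈ Ioo 0 (Real.pi / g)) {p : M} (hk : HasPrincipalCurvatures (f τ) (N τ) p k) {s : ℝ}
    (hs : s ∈ Ioo (τ - Real.pi / g) τ) (i : Fin n) : Real.cos s - k i * Real.sin s ≠ 0 := by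
  have hσ : τ - s ∈ Ioo 0 (Real.pi / g) := ⟨by linarith [hs.2], by linarith [hs.1]⟩
  intro h0
  refine (hf.hypersurface τ hτ).not_injective_of_cos_eq hk (sub_eq_zero.1 h0) ?_
  have h1 : (fun q => sphereExp (f τ q) (N τ q) s) = f (τ - s) := by
    funext q; rw [hf.parallel τ hτ _ hσ, sub_sub_cancel]
  rw [h1]
  exact (hf.hypersurface _ hσ).immersion p

theorem hasPrincipalCurvatures_parallel (hf : IsIsoparametricFamily g P f N)
    (hτ : τ ∈ Ioo 0 (Real.pi / g)) {p : M} (hk : HasPrincipalCurvatures (f τ) (N τ) p k) {s : ℝ}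
    (hs : s ∈ Ioo (τ - Real.pi / g) τ) :
    HasPrincipalCurvatures (f (τ - s)) (N (τ - s)) p (parallelCurvatures k s) := by
  have hσ : τ - s ∈ Ioo 0 (Real.pi / g) := ⟨by linarith [hs.2], by linarith [hs.1]⟩
  have h := hf.hypersurface τ hτ
  have h1 : f (τ - s) = fun q => sphereExp (f τ q) (N τ q) s := by
    funext q; rw [hf.parallel τ hτ _ hσ, sub_sub_cancel]
  have h2 : N (τ - s) = fun q => sphereExpVelocity (f τ q) (N τ q) s := by
    funext q; rw [hf.normal_eq hτ hσ, sub_sub_cancel]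
  have hne := hf.cos_sub_mul_sin_ne_zero hτ hk hs
  obtain ⟨b, hb⟩ := hk
  refine ⟨b, fun i => ?_⟩
  rw [h1, h2, h.mvfderiv_sphereExp_eigenvector (hb i),
    h.mvfderiv_sphereExpVelocity_eigenvector (hb i), smul_smul, parallelCurvatures, neg_mul,
    div_mul_cancel₀ _ (hne i)]

/-- Symmetry of `W` removes the arbitrary order in `principalCurvatures`. The value found depends on
`s` and `k` only, which makes the speed a function of `s`. -/
theorem weingartenOf_parallel (hf : IsIsoparametricFamily g P f N) (hW : IsWeingartenFunction Γ W)
    (hΓ : ∀ τ ∈ Ioo 0 (Real.pi / g), WeingartenWellDefined Γ (f τ) (N τ))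
    (hτ : τ ∈ Ioo 0 (Real.pi / g)) {p : M} (hk : HasPrincipalCurvatures (f τ) (N τ) p k) {s : ℝ}
    (hs : s ∈ Ioo (τ - Real.pi / g) τ) :
    parallelCurvatures k s ∈ Γ ∧
      weingartenOf W (f (τ - s)) (N (τ - s)) p = W (parallelCurvatures k s) := by
  have hσ : τ - s ∈ Ioo 0 (Real.pi / g) := ⟨by linarith [hs.2], by linarith [hs.1]⟩
  obtain ⟨π, hπ⟩ := (hf.hypersurface _ hσ).exists_perm_principalCurvatures
    (hf.hasPrincipalCurvatures_parallel hτ hk hs)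
  have := hW.symmetric _ (hΓ _ hσ p) π
  rw [hπ] at this
  exact ⟨this.1, this.2.symm⟩

theorem contDiffOn_weingarten_parallel (hf : IsIsoparametricFamily g P f N)
    (hW : IsWeingartenFunction Γ W)
    (hΓ : ∀ τ ∈ Ioo 0 (Real.pi / g), WeingartenWellDefined Γ (f τ) (N τ))
    (hτ : τ ∈ Ioo 0 (Real.pi / g)) {p : M} (hk : HasPrincipalCurvatures (f τ) (N τ) p k) :
    ContDiffOn ℝ ∞ (fun s => W (parallelCurvatures k s)) (Ioo (τ - Real.pi / g) τ) := by
  refine hW.smooth.comp (f := parallelCurvatures k) ?_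
    fun s hs => (hf.weingartenOf_parallel hW hΓ hτ hk hs).1
  rw [contDiffOn_pi]
  intro i
  have hc : ContDiff ℝ ∞ fun s : ℝ => Real.cos s := Real.contDiff_cos
  have hsn : ContDiff ℝ ∞ fun s : ℝ => Real.sin s := Real.contDiff_sin
  exact ((contDiff_const.mul hc).add hsn).contDiffOn.div
    (hc.sub (contDiff_const.mul hsn)).contDiffOn
    fun s hs => hf.cos_sub_mul_sin_ne_zero hτ hk hs i

theorem parallelMap_eq (hf : IsIsoparametricFamily g P f N) (hτ : τ ∈ Ioo 0 (Real.pi / g))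
    {φ : ℝ → ℝ} {t : ℝ} (ht : φ t ∈ Ioo (τ - Real.pi / g) τ) :
    parallelMap (f τ) (N τ) φ t = f (τ - φ t) := by
  have hσ : τ - φ t ∈ Ioo 0 (Real.pi / g) := ⟨by linarith [ht.2], by linarith [ht.1]⟩
  funext q
  rw [hf.parallel τ hτ _ hσ, sub_sub_cancel]
  rfl

theorem parallelNormal_eq (hf : IsIsoparametricFamily g P f N) (hτ : τ ∈ Ioo 0 (Real.pi / g))
    {φ : ℝ → ℝ} {t : ℝ} (ht : φ t ∈ Ioo (τ - Real.pi / g) τ) :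
    parallelNormal (f τ) (N τ) φ t = N (τ - φ t) := by
  have hσ : τ - φ t ∈ Ioo 0 (Real.pi / g) := ⟨by linarith [ht.2], by linarith [ht.1]⟩
  funext q
  rw [hf.normal_eq hτ hσ, sub_sub_cancel]
  rfl

theorem isParallelWFlow (hf : IsIsoparametricFamily g P f N) (hW : IsWeingartenFunction Γ W)
    (hΓ : ∀ τ ∈ Ioo 0 (Real.pi / g), WeingartenWellDefined Γ (f τ) (N τ))
    (hτ : τ ∈ Ioo 0 (Real.pi / g)) (hk : ∀ p, HasPrincipalCurvatures (f τ) (N τ) p k)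
    {φ : ℝ → ℝ} {T : ℝ} (hT : 0 < T) (h0 : φ 0 = 0) (hφ : ContDiffOn ℝ ∞ φ (Ico 0 T))
    (hmem : ∀ t ∈ Ico 0 T, φ t ∈ Ioo (τ - Real.pi / g) τ)
    (hder : ∀ t ∈ Ico 0 T,
      HasDerivWithinAt φ (W (parallelCurvatures k (φ t))) (Ico 0 T) t) :
    IsParallelWFlow Γ W (f τ) (N τ) φ T := by
  have hσ : ∀ t ∈ Ico 0 T, τ - φ t ∈ Ioo 0 (Real.pi / g) := fun t ht =>
    ⟨by linarith [(hmem t ht).2], by linarith [(hmem t ht).1]⟩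
  refine ⟨by exact_mod_cast hT, h0, ?_, ?_, ?_, ?_⟩ <;> rw [timeInterval_coe]
  · exact hφ
  · intro t ht
    rw [hf.parallelMap_eq hτ (hmem t ht), hf.parallelNormal_eq hτ (hmem t ht)]
    exact hf.hypersurface _ (hσ t ht)
  · intro t ht
    rw [hf.parallelMap_eq hτ (hmem t ht), hf.parallelNormal_eq hτ (hmem t ht)]
    exact hΓ _ (hσ t ht)
  · intro t ht p
    have h1 := (hasDerivAt_sphereExp (f τ p) (N τ p) (φ t)).scomp_hasDerivWithinAt t (hder t ht)
    have h2 := (hf.weingartenOf_parallel hW hΓ hτ (hk p) (hmem t ht)).2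
    rw [← hf.parallelMap_eq hτ (hmem t ht), ← hf.parallelNormal_eq hτ (hmem t ht)] at h2
    rw [h2]
    exact h1

/-- The converse reduction: the chain rule and the evolution equation give two multiples of the same
unit velocity vector, whose coefficients must agree. -/
theorem hasDerivWithinAt_of_isParallelWFlow [Nonempty M] (hf : IsIsoparametricFamily g P f N)
    (hW : IsWeingartenFunction Γ W)
    (hΓ : ∀ τ ∈ Ioo 0 (Real.pi / g), WeingartenWellDefined Γ (f τ) (N τ))
    (hτ : τ ∈ Ioo 0 (Real.pi / g)) (hk : ∀ p, HasPrincipalCurvatures (f τ) (N τ) p k)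
    {ψ : ℝ → ℝ} {S : EReal} (hψ : IsParallelWFlow Γ W (f τ) (N τ) ψ S) {t : ℝ}
    (ht : t ∈ timeInterval S) (hmem : ψ t ∈ Ioo (τ - Real.pi / g) τ) :
    HasDerivWithinAt ψ (W (parallelCurvatures k (ψ t))) (timeInterval S) t := by
  obtain ⟨p⟩ := ‹Nonempty M›
  have hud : UniqueDiffWithinAt ℝ (timeInterval S) t := by
    obtain ⟨u, htu, huS⟩ := EReal.lt_iff_exists_real_btwn.1 ht.2
    have htu' : t < u := EReal.coe_lt_coe_iff.1 htu
    have hu : u ∈ timeInterval S := ⟨ht.1.trans htu'.le, huS⟩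
    exact (uniqueDiffOn_Icc (ht.1.trans_lt htu') t ⟨ht.1, htu'.le⟩).mono
      fun v hv => mem_timeInterval_of_le hu hv.1 hv.2
  have hd : HasDerivWithinAt ψ (derivWithin ψ (timeInterval S) t) (timeInterval S) t :=
    (hψ.smooth.differentiableOn (by simp) t ht).hasDerivWithinAt
  have h1 := (hasDerivAt_sphereExp (f τ p) (N τ p) (ψ t)).scomp_hasDerivWithinAt t hd
  have h2 := hψ.evolution t ht p
  have h3 := (hf.weingartenOf_parallel hW hΓ hτ (hk p) hmem).2
  rw [← hf.parallelMap_eq hτ hmem, ← hf.parallelNormal_eq hτ hmem] at h3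
  rw [h3] at h2
  have hV : sphereExpVelocity (f τ p) (N τ p) (ψ t) ≠ 0 := by
    intro h0
    have := hf.norm_sphereExpVelocity hτ p (ψ t)
    rw [h0, norm_zero] at this
    exact zero_ne_one this
  have h4 := smul_left_injective ℝ hV (hud.eq_deriv _ h1 h2)
  rwa [h4] at hd

/-- The maps of a flow are immersions, while focal maps are not; this bars every competitor from the
focal distances. -/
theorem ne_of_isParallelWFlow [Nonempty M] (hf : IsIsoparametricFamily g P f N)
    (hτ : τ ∈ Ioo 0 (Real.pi / g)) {ψ : ℝ → ℝ} {S : EReal}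
    (hψ : IsParallelWFlow Γ W (f τ) (N τ) ψ S) {t : ℝ} (ht : t ∈ timeInterval S) (m : ℤ) :
    ψ t ≠ τ - m * (Real.pi / g) := by
  intro h
  obtain ⟨p⟩ := ‹Nonempty M›
  refine hf.not_injective_focalMap hτ m p ?_
  rw [← h]
  exact (hψ.hypersurface t ht).immersion p

/-- Convergence is uniform because points on a great circle move by an amount bounded in terms of
the parameter alone. The focal sets `𝓕₊` and `𝓕₋` are the cases `c = 1`, `m = 0` and `c = -1`, `m =
1`. -/
theorem collapsesInto [Nonempty M] (hf : IsIsoparametricFamily g P f N)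
    (hτ : τ ∈ Ioo 0 (Real.pi / g)) {φ : ℝ → ℝ} {T c : ℝ} {m : ℤ} (hc : -1 ≤ c) (hc' : c ≤ 1)
    (hm : Real.arccos c = m * Real.pi)
    (hφ : Tendsto φ (𝓝[<] T) (𝓝 (τ - m * (Real.pi / g)))) :
    CollapsesInto (parallelMap (f τ) (N τ) φ) (sphereLevel P c) T := by
  have h := hf.hypersurface τ hτ
  refine ⟨fun q => sphereExp (f τ q) (N τ q) (τ - m * (Real.pi / g)), ?_, ?_,
    h.contMDiff_sphereExp _, hf.not_injective_focalMap hτ m⟩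
  · rw [Metric.tendstoUniformly_iff]
    intro ε hε
    set e := τ - m * (Real.pi / g)
    let D : ℝ → ℝ := fun s => |Real.cos e - Real.cos s| + |Real.sin e - Real.sin s|
    have hD : Continuous D := by fun_prop
    have hDφ : Tendsto (fun t => D (φ t)) (𝓝[<] T) (𝓝 (D e)) := (hD.tendsto e).comp hφ
    have hDe : D e = 0 := by simp [D]
    rw [hDe] at hDφ
    filter_upwards [hDφ.eventually_lt_const hε] with t ht q
    rw [dist_eq_norm]
    exact (norm_sphereExp_sub_le (h.norm_eq q) (h.norm_normal q) _ _).trans_lt ht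
  · rw [← hf.range_focalMap hτ hc hc', hm, mul_div_assoc]

end IsIsoparametricFamily

end ParallelFlows

/-! ### The main theorem -/

theorem theorem1p2 {n g : ℕ} {M : Type*} [TopologicalSpace M]
    [ChartedSpace (EuclideanSpace ℝ (Fin n)) M] [IsManifold (𝓡 n) ∞ M] [Nonempty M]
    (P : MvPolynomial (Fin (n + 2)) ℝ) (f N : ℝ → M → Amb n)
    (hf : IsIsoparametricFamily g P f N)
    (Γ : Set (Fin n → ℝ)) (W : (Fin n → ℝ) → ℝ) (hW : IsWeingartenFunction Γ W)
    (hΓ : ∀ τ ∈ Ioo 0 (Real.pi / g), WeingartenWellDefined Γ (f τ) (N τ))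
    (τ₀ : ℝ) (hτ₀ : τ₀ ∈ Ioo 0 (Real.pi / g)) :
    ((∀ p, 0 < weingartenOf W (f τ₀) (N τ₀) p) →
      (∀ p, MonotoneOn (fun s => weingartenOf W (f (τ₀ - s)) (N (τ₀ - s)) p) (Ico 0 τ₀)) →
      ∃ (φ : ℝ → ℝ) (T : ℝ),
        IsMaximalParallelWFlow Γ W (f τ₀) (N τ₀) φ T ∧
        (∀ t ∈ Ico 0 T, φ t ∈ Ico 0 τ₀ ∧ parallelMap (f τ₀) (N τ₀) φ t = f (τ₀ - φ t)) ∧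
        StrictMonoOn φ (Ico 0 T) ∧
        Tendsto φ (𝓝[<] T) (𝓝 τ₀) ∧
        CollapsesInto (parallelMap (f τ₀) (N τ₀) φ) (focalPlus P) T) ∧
    ((∀ p, weingartenOf W (f τ₀) (N τ₀) p < 0) →
      (∀ p, AntitoneOn (fun s => weingartenOf W (f (τ₀ + s)) (N (τ₀ + s)) p)
        (Ico 0 (Real.pi / g - τ₀))) →
      ∃ (φ : ℝ → ℝ) (T : ℝ),
        IsMaximalParallelWFlow Γ W (f τ₀) (N τ₀) φ T ∧
        (∀ t ∈ Ico 0 T, φ t ∈ Ioc (τ₀ - Real.pi / g) 0 ∧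
          parallelMap (f τ₀) (N τ₀) φ t = f (τ₀ - φ t)) ∧
        StrictAntiOn φ (Ico 0 T) ∧
        Tendsto φ (𝓝[<] T) (𝓝 (τ₀ - Real.pi / g)) ∧
        CollapsesInto (parallelMap (f τ₀) (N τ₀) φ) (focalMinus P) T) := by
  obtain ⟨k, hk, -⟩ := hf.isoparametric τ₀ hτ₀
  obtain ⟨p⟩ := ‹Nonempty M›
  have hne : Nonempty M := ⟨p⟩
  set h : ℝ → ℝ := fun s => W (parallelCurvatures k s) with hh
  have hsm : ContDiffOn ℝ ∞ h (Ioo (τ₀ - Real.pi / g) τ₀) :=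
    hf.contDiffOn_weingarten_parallel hW hΓ hτ₀ (hk p)
  have hval : ∀ s ∈ Ioo (τ₀ - Real.pi / g) τ₀,
      weingartenOf W (f (τ₀ - s)) (N (τ₀ - s)) p = h s := fun s hs =>
    (hf.weingartenOf_parallel hW hΓ hτ₀ (hk p) hs).2
  have hleft : τ₀ - Real.pi / g < 0 := sub_neg.2 hτ₀.2
  have hval0 : weingartenOf W (f τ₀) (N τ₀) p = h 0 := by
    simpa using hval 0 ⟨hleft, hτ₀.1⟩
  constructor
  · intro hpos hmono
    have hmono' : MonotoneOn h (Ico 0 τ₀) := (hmono p).congr fun s hs =>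
      hval s ⟨hleft.trans_le hs.1, hs.2⟩
    obtain ⟨φ, T, hT, hφ0, hφsm, hφmem, hφd, hφm, hφT, hmax⟩ :=
      exists_maximal_solution_of_monotoneOn hleft hτ₀.1 hsm (hval0 ▸ hpos p) hmono'
    have hmem : ∀ t ∈ Ico 0 T, φ t ∈ Ioo (τ₀ - Real.pi / g) τ₀ := fun t ht =>
      ⟨hleft.trans_le (hφmem t ht).1, (hφmem t ht).2⟩
    refine ⟨φ, T, ⟨hf.isParallelWFlow hW hΓ hτ₀ hk hT hφ0 hφsm hmem hφd, fun ψ S hψ => ?_⟩,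
      fun t ht => ⟨hφmem t ht, hf.parallelMap_eq hτ₀ (hmem t ht)⟩, hφm, hφT, ?_⟩
    · refine hmax ψ S hψ.zero (hψ.smooth.differentiableOn (by simp))
        (fun t ht h' => hf.hasDerivWithinAt_of_isParallelWFlow hW hΓ hτ₀ hk hψ ht h')
        fun t ht => ?_
      simpa using hf.ne_of_isParallelWFlow hτ₀ hψ ht 0
    · exact hf.collapsesInto hτ₀ (m := 0) (by norm_num) le_rfl (by simp) (by simpa using hφT)
  · intro hneg hanti
    have hneg' : ∀ s ∈ Ioo (-τ₀) (Real.pi / g - τ₀), -s ∈ Ioo (τ₀ - Real.pi / g) τ₀ := fun s hs =>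
      ⟨by linarith [hs.2], by linarith [hs.1]⟩
    -- The reflected speed `-h (-s)` is positive at `0` and increasing, so the scalar result applies
    -- to `-φ` with endpoint `π/g - τ₀`.
    have hsm' : ContDiffOn ℝ ∞ (fun s => -h (-s)) (Ioo (-τ₀) (Real.pi / g - τ₀)) :=
      (hsm.comp contDiff_neg.contDiffOn hneg').neg
    have hleft' : -τ₀ < 0 := neg_lt_zero.2 hτ₀.1
    have hmono' : MonotoneOn (fun s => -h (-s)) (Ico 0 (Real.pi / g - τ₀)) :=
      (hanti p).neg.congr fun s hs => by
        have := hval (-s) (hneg' s ⟨hleft'.trans_le hs.1, hs.2⟩)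
        rw [sub_neg_eq_add] at this
        exact congrArg Neg.neg this
    obtain ⟨φ, T, hT, hφ0, hφsm, hφmem, hφd, hφm, hφT, hmax⟩ :=
      exists_maximal_solution_of_monotoneOn hleft' (sub_pos.2 hτ₀.2) hsm'
        (by simpa [hval0] using hneg p) hmono'
    have hmem : ∀ t ∈ Ico 0 T, -φ t ∈ Ioo (τ₀ - Real.pi / g) τ₀ := fun t ht =>
      hneg' _ ⟨hleft'.trans_le (hφmem t ht).1, (hφmem t ht).2⟩
    have hφT' : Tendsto (fun t => -φ t) (𝓝[<] T) (𝓝 (τ₀ - Real.pi / g)) := by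
      simpa using hφT.neg
    refine ⟨fun t => -φ t, T, ⟨hf.isParallelWFlow hW hΓ hτ₀ hk hT (by simp [hφ0]) hφsm.neg hmem
      fun t ht => by simpa using (hφd t ht).fun_neg, fun ψ S hψ => ?_⟩,
      fun t ht => ⟨⟨(hmem t ht).1, neg_nonpos.2 (hφmem t ht).1⟩,
        hf.parallelMap_eq (φ := fun t => -φ t) hτ₀ (hmem t ht)⟩, hφm.neg, hφT', ?_⟩
    · obtain ⟨h1, h2⟩ := hmax (fun t => -ψ t) S (by simp [hψ.zero])
        (hψ.smooth.differentiableOn (by simp)).fun_neg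
        (fun t ht h' => by
          have h'' := hneg' _ h'
          rw [neg_neg] at h''
          simpa using
            (hf.hasDerivWithinAt_of_isParallelWFlow hW hΓ hτ₀ hk hψ ht h'').fun_neg)
        fun t ht h' => hf.ne_of_isParallelWFlow hτ₀ hψ ht 1 (by push_cast; linarith)
      exact ⟨h1, fun t ht => neg_eq_iff_eq_neg.1 (h2 ht)⟩
    · exact hf.collapsesInto hτ₀ (m := 1) le_rfl (by norm_num) (by simp) (by simpa using hφT')
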